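/- Let $X$ be a CAT(0) cube complex, that is, a complex of Euclidean unit cubes glued along faces by isometries (any two cubes being disjoint or meeting in a common face) which is simply connected and in which the link of every vertex is a flag complex. A \emph{midplane} of a $q$-cube $[-\frac12,\frac12]^q$ is its intersection with a coordinate hyperplane; two midplanes are equivalent if they are the first and last members of a finite sequence of midplanes in which the intersection of any two consecutive ones is again a midplane; a \emph{hyperplane} is the union of the midplanes in an equivalence class, and it \emph{cuts} a cube if it contains a midplane of that cube. Two cubes are \emph{parallel} if they have the same dimension and every hyperplane that cuts the first also cuts the second. Let $d$ be the edge-path metric on the vertices of $X$, and for a vertex $P$ and a cube $C$ let $d(P,C)$ be the minimum of $d(P,v)$ over the vertices $v$ of $C$. Let $P$ be a vertex of $X$, let $q\ge 0$, and let $\mathcal C$ be a parallelism class of $q$-cubes in $X$. Then: (1) there is exactly one cube $C\in\mathcal C$ with $d(P,C)\le d(P,D)$ for all $D\in\mathcal C$; (2) among all the vertices of the cubes in $\mathcal C$ there is exactly one vertex $R$ at minimal distance from $P$, and it satisfies the addition formula $$d(P,S)=d(P,R)+d(R,S)$$ for every vertex $S$ of every cube in $\mathcal C$. -/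

import Mathlib

/-- `φ` identifies the vertex set `{0,1}^q` of the standard `q`-cube with `C`, in such a way that
the members of the family `𝒦` that are contained in `C` are exactly the (images of the) faces of
the standard cube.  A face of the standard cube is obtained by fixing the coordinates in some
set `s` of directions. -/
def IsCubeChart {V : Type*} (𝒦 : Set (Set V)) (C : Set V) {q : ℕ}
    (φ : (Fin q → Bool) → V) : Prop :=
  Function.Injective φ ∧ Set.range φ = C ∧
    ∀ D : Set V, D ⊆ C →
      (D ∈ 𝒦 ↔ ∃ (s : Set (Fin q)) (a : Fin q → Bool), D = φ '' {x | ∀ i ∈ s, x i = a i})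

/-- A cube complex with vertex set `V`: a complex of Euclidean unit cubes glued along faces by
isometries, in which the intersection of two cubes is empty or a common face of both.  Each cube
is recorded by its set of vertices, which determines it. -/
structure CubeComplex (V : Type*) where
  /-- The (vertex sets of the) cubes of all dimensions. -/
  cubes : Set (Set V)
  exists_chart : ∀ C ∈ cubes, ∃ (q : ℕ) (φ : (Fin q → Bool) → V), IsCubeChart cubes C φ
  singleton_mem : ∀ v : V, {v} ∈ cubes
  inter_mem : ∀ C ∈ cubes, ∀ D ∈ cubes, (C ∩ D).Nonempty → C ∩ D ∈ cubes

namespace CubeComplex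

variable {V : Type*} (X : CubeComplex V)

/-- `C` is (the vertex set of) a `q`-dimensional cube of `X`. -/
def IsCube (q : ℕ) (C : Set V) : Prop :=
  C ∈ X.cubes ∧ ∃ φ : (Fin q → Bool) → V, IsCubeChart X.cubes C φ

/-- The graph of vertices and edges of `X`. The edge-path metric is its graph distance. -/
def oneSkeleton : SimpleGraph V where
  Adj u v := u ≠ v ∧ X.IsCube 1 {u, v}
  symm := ⟨fun u v h => ⟨h.1.symm, by rw [Set.pair_comm]; exact h.2⟩⟩
  loopless := ⟨fun _ h => h.1 rfl⟩

/-- The edge-path distance between two vertices. -/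
noncomputable def edgeDist (P Q : V) : ℕ := X.oneSkeleton.dist P Q

/-- The distance from the vertex `P` to the closest vertex of the cube `C`. -/
noncomputable def distToCube (P : V) (C : Set V) : ℕ := sInf (X.edgeDist P '' C)

/-! ### Simple connectivity and the link condition -/

/-- Elementary homotopies of edge paths: insertion of a backtrack, and pushing a path across a
square from one side to the other. -/
inductive ElemHomotopy : ∀ {u v : V}, X.oneSkeleton.Walk u v → X.oneSkeleton.Walk u v → Prop
  | backtrack {u v a b : V} (p : X.oneSkeleton.Walk u a) (h : X.oneSkeleton.Adj a b)
      (r : X.oneSkeleton.Walk a v) :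
      ElemHomotopy (p.append r) (p.append (.cons h (.cons h.symm r)))
  | square {u v a b c d : V} (p : X.oneSkeleton.Walk u a)
      (hab : X.oneSkeleton.Adj a b) (hbc : X.oneSkeleton.Adj b c)
      (had : X.oneSkeleton.Adj a d) (hdc : X.oneSkeleton.Adj d c)
      (hsq : X.IsCube 2 {a, b, c, d}) (r : X.oneSkeleton.Walk c v) :
      ElemHomotopy (p.append (.cons hab (.cons hbc r))) (p.append (.cons had (.cons hdc r)))

/-- `X` is nonempty and connected, and its edge-path fundamental group is trivial. -/
def IsSimplyConnected : Prop :=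
  X.oneSkeleton.Connected ∧
    ∀ (v : V) (p : X.oneSkeleton.Walk v v), Relation.EqvGen X.ElemHomotopy p .nil

/-- The finite set `S` of neighbours of the vertex `v` (that is, of vertices of the link of `v`)
spans a simplex of the link of `v`: the edges from `v` to `S` span a cube. -/
def SpansLinkSimplex (v : V) (S : Finset V) : Prop :=
  ∃ C : Set V, X.IsCube S.card C ∧ v ∈ C ∧ (S : Set V) ⊆ C

/-- The link of every vertex is a flag complex: finitely many vertices of the link, any two of
which are joined by an edge of the link, span a simplex of the link.  (Two neighbours of `v` are
joined in the link when they lie with `v` in a square.) -/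
def HasFlagLinks : Prop :=
  ∀ (v : V) (S : Finset V), (∀ a ∈ S, X.oneSkeleton.Adj v a) →
    (∀ a ∈ S, ∀ b ∈ S, a ≠ b → ∃ C : Set V, X.IsCube 2 C ∧ v ∈ C ∧ a ∈ C ∧ b ∈ C) →
    X.SpansLinkSimplex v S

/-- `X` is a CAT(0) cube complex: it is simply connected and nonpositively curved. -/
def IsCAT0 : Prop := X.IsSimplyConnected ∧ X.HasFlagLinks

/-! ### Hyperplanes and parallelism

A midplane, and so also a hyperplane, is recorded by the set of edges that it crosses (that is,
the edges whose midpoints it contains).  The intersection of two midplanes is again a midplane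
if and only if this is so for the corresponding sets of edges. -/

/-- `M` is a midplane of the cube `C`: the set of all edges of `C` in one coordinate direction. -/
def IsMidplaneOf (C : Set V) (M : Set (Sym2 V)) : Prop :=
  ∃ (q : ℕ) (φ : (Fin q → Bool) → V) (i : Fin q), IsCubeChart X.cubes C φ ∧
    M = Set.range fun x : Fin q → Bool => s(φ x, φ (Function.update x i (!(x i))))

/-- `M` is a midplane of some cube of `X`. -/
def IsMidplane (M : Set (Sym2 V)) : Prop := ∃ C ∈ X.cubes, X.IsMidplaneOf C M

/-- Two midplanes are equivalent if they are the first and last members of a finite sequence of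
midplanes in which the intersection of any two consecutive ones is again a midplane. -/
def MidplaneEquiv (M N : Set (Sym2 V)) : Prop :=
  Relation.ReflTransGen
    (fun A B => X.IsMidplane A ∧ X.IsMidplane B ∧ X.IsMidplane (A ∩ B)) M N

/-- A hyperplane is the union of the midplanes in an equivalence class of midplanes. -/
def IsHyperplane (H : Set (Sym2 V)) : Prop :=
  ∃ M, X.IsMidplane M ∧ H = ⋃₀ {N | X.MidplaneEquiv M N}

/-- The hyperplane `H` cuts the cube `C` if it contains a midplane of `C`. -/
def Cuts (H : Set (Sym2 V)) (C : Set V) : Prop := ∃ M, X.IsMidplaneOf C M ∧ M ⊆ H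

/-- Two cubes are parallel if they have the same dimension, and every hyperplane that cuts the
first also cuts the second. -/
def Parallel (C D : Set V) : Prop :=
  (∃ q, X.IsCube q C ∧ X.IsCube q D) ∧ ∀ H, X.IsHyperplane H → X.Cuts H C → X.Cuts H D

/-- `𝒞` is a parallelism class of `q`-cubes. -/
def IsParallelismClass (q : ℕ) (𝒞 : Set (Set V)) : Prop :=
  ∃ C, X.IsCube q C ∧ 𝒞 = {D | X.Parallel C D}

/-- `R` is a vertex, among the vertices of all the cubes in `𝒞`, at minimal distance from `P`. -/
def IsNearestVertex (P : V) (𝒞 : Set (Set V)) (R : V) : Prop :=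
  R ∈ ⋃₀ 𝒞 ∧ ∀ S ∈ ⋃₀ 𝒞, X.edgeDist P R ≤ X.edgeDist P S

end CubeComplex

/-! The vertices of the cubes in a parallelism class form the intersection of the carriers of the
`q` hyperplanes that cut one of these cubes (`IsCornerSystem.sUnion_parallel_eq`). Each carrier is
convex for the edge-path metric, hence so is the intersection, and a nonempty convex set is gated
(`IsCAT0.exists_isGate_of_isConvex`): it has a point R with d(P,S) = d(P,R) + d(R,S) for all S in
it. This is the addition formula, and it makes R the only nearest vertex. Cubes of the class that
share a vertex coincide (`IsCAT0.eq_of_parallel`), so the cube through R is the only nearest cube.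

The metric facts rest on the quadrangle condition (`IsCAT0.quadrangle`): two neighbours of z that
are one step closer to P lie with z in a square whose fourth vertex is two steps closer. Descent
towards P is therefore confluent (`IsCAT0.join_descends`). This is applied to the vertices of a set,
which gives gates, and to oriented edges, which shows that an edge is determined by its parallelism
class and its first endpoint.

Simple connectivity and flag links enter through edge paths up to pushing across squares. Three
squares around a corner fill to a cube, which gives the exchange property `SwapEquiv.eq_or_square`.
By it, walks act on classes of reduced edge paths, and homotopic walks act alike. Since loops are
null-homotopic, reduced paths with the same endpoints are equivalent (`IsReduced.swapEquiv`).
Geodesics are reduced, so exchange applied to two geodesics ending at z gives the square of the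
quadrangle condition. -/

namespace CubeComplex

variable {V : Type*} {X : CubeComplex V}

/-! ### Cubes and their faces -/

/-- The vertex of the standard cube that differs from `x` exactly in the direction `i`. -/
def flipAt {q : ℕ} (x : Fin q → Bool) (i : Fin q) : Fin q → Bool :=
  Function.update x i (!(x i))

section flipAt

variable {q : ℕ} (x : Fin q → Bool) (i j : Fin q)

@[simp] lemma flipAt_same : flipAt x i i = !(x i) := by simp [flipAt]

lemma flipAt_of_ne {i j : Fin q} (h : j ≠ i) : flipAt x i j = x j := by simp [flipAt, h]

@[simp] lemma flipAt_flipAt : flipAt (flipAt x i) i = x := by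
  funext k
  by_cases h : k = i
  · subst h; simp
  · simp [flipAt_of_ne _ h]

lemma flipAt_ne : flipAt x i ≠ x := fun h => by
  have := congrFun h i
  simp at this

lemma flipAt_comm : flipAt (flipAt x i) j = flipAt (flipAt x j) i := by
  by_cases hij : i = j
  · rw [hij]
  funext k
  by_cases hi : k = i
  · subst hi; rw [flipAt_of_ne _ hij]; simp [flipAt_of_ne _ hij]
  · by_cases hj : k = j
    · subst hj; rw [flipAt_of_ne _ hi]; simp [flipAt_of_ne _ hi]
    · simp [flipAt_of_ne _ hi, flipAt_of_ne _ hj]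

lemma flipAt_injective : Function.Injective (flipAt x) := fun i j h => by
  by_contra hij
  have := congrFun h i
  simp [flipAt_of_ne _ hij] at this

end flipAt

/-- A face of a cube with `k` free directions is a `k`-cube. -/
lemma _root_.IsCubeChart.restrict {𝒦 : Set (Set V)} {C : Set V} {q k : ℕ} {φ : (Fin q → Bool) → V}
    (h : IsCubeChart 𝒦 C φ) (e : (Fin k → Bool) → (Fin q → Bool)) (σ : Fin k → Fin q)
    (he : ∀ b j, e b (σ j) = b j) (he' : ∀ b b' i, i ∉ Set.range σ → e b i = e b' i) :
    IsCubeChart 𝒦 (Set.range (φ ∘ e)) (φ ∘ e) := by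
  obtain ⟨hinj, hran, hface⟩ := h
  have einj : Function.Injective e := fun b b' hb => by
    funext j; rw [← he b, ← he b', hb]
  refine ⟨hinj.comp einj, rfl, fun D hD => ?_⟩
  have hDC : D ⊆ C := by
    rw [← hran]; exact hD.trans (Set.range_comp_subset_range _ _)
  rw [hface D hDC]
  constructor
  · rintro ⟨s, a, rfl⟩
    refine ⟨σ ⁻¹' s, a ∘ σ, ?_⟩
    have key : ∀ x : Fin q → Bool, (∀ i ∈ s, x i = a i) → ∃ b, e b = x := fun x hx => by
      obtain ⟨b, hb⟩ := hD ⟨x, hx, rfl⟩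
      exact ⟨b, hinj hb⟩
    obtain ⟨b₀, hb₀⟩ := key a (fun _ _ => rfl)
    ext v
    constructor
    · rintro ⟨x, hx, rfl⟩
      obtain ⟨b, rfl⟩ := key x hx
      exact ⟨b, fun j hj => by rw [← he b j, hx _ hj]; rfl, rfl⟩
    · rintro ⟨b, hb, rfl⟩
      refine ⟨e b, fun i hi => ?_, rfl⟩
      by_cases hr : i ∈ Set.range σ
      · obtain ⟨j, rfl⟩ := hr
        rw [he, hb j hi]; rfl
      · rw [he' b b₀ i hr, hb₀]
  · rintro ⟨t, c, rfl⟩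
    refine ⟨σ '' t ∪ (Set.range σ)ᶜ, e c, ?_⟩
    ext v
    constructor
    · rintro ⟨b, hb, rfl⟩
      refine ⟨e b, ?_, rfl⟩
      rintro i (⟨j, hj, rfl⟩ | hi)
      · rw [he, he, hb j hj]
      · exact he' _ _ _ hi
    · rintro ⟨x, hx, rfl⟩
      refine ⟨x ∘ σ, fun j hj => ?_, ?_⟩
      · have := hx (σ j) (Or.inl ⟨j, hj, rfl⟩)
        rw [he] at this; exact this
      · have : e (x ∘ σ) = x := by
          funext i
          by_cases hr : i ∈ Set.range σ
          · obtain ⟨j, rfl⟩ := hr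
            rw [he]; rfl
          · rw [he' _ c i hr, hx i (Or.inr hr)]
        simp [this]

lemma _root_.IsCubeChart.mem_cubes {𝒦 : Set (Set V)} {C : Set V} {q : ℕ} {φ : (Fin q → Bool) → V}
    (h : IsCubeChart 𝒦 C φ) : C ∈ 𝒦 :=
  (h.2.2 C subset_rfl).2 ⟨∅, fun _ => false, by simp [h.2.1]⟩

lemma _root_.IsCubeChart.isCube {C : Set V} {q : ℕ} {φ : (Fin q → Bool) → V}
    (h : IsCubeChart X.cubes C φ) : X.IsCube q C :=
  ⟨h.mem_cubes, φ, h⟩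

lemma _root_.IsCubeChart.ncard {𝒦 : Set (Set V)} {C : Set V} {q : ℕ} {φ : (Fin q → Bool) → V}
    (h : IsCubeChart 𝒦 C φ) : C.ncard = 2 ^ q := by
  rw [← h.2.1, ← Set.image_univ, Set.ncard_image_of_injective _ h.1, Set.ncard_univ]
  simp

lemma _root_.IsCubeChart.mem {𝒦 : Set (Set V)} {C : Set V} {q : ℕ} {φ : (Fin q → Bool) → V}
    (h : IsCubeChart 𝒦 C φ) (x : Fin q → Bool) : φ x ∈ C := h.2.1 ▸ Set.mem_range_self x

lemma _root_.IsCubeChart.exists_eq {𝒦 : Set (Set V)} {C : Set V} {q : ℕ} {φ : (Fin q → Bool) → V}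
    (h : IsCubeChart 𝒦 C φ) {v : V} (hv : v ∈ C) : ∃ x, φ x = v := by
  rw [← h.2.1] at hv; exact hv

lemma _root_.IsCubeChart.adj_flipAt {C : Set V} {q : ℕ} {φ : (Fin q → Bool) → V}
    (h : IsCubeChart X.cubes C φ) (x : Fin q → Bool) (i : Fin q) :
    X.oneSkeleton.Adj (φ x) (φ (flipAt x i)) := by
  refine ⟨fun he => flipAt_ne x i (h.1 he).symm, ?_⟩
  have := (h.restrict (fun b : Fin 1 → Bool => Function.update x i (b 0)) (fun _ => i)
    (fun b j => by simp [Subsingleton.elim j 0])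
    (fun b b' k hk => by
      have : k ≠ i := fun h => hk ⟨0, h.symm⟩
      simp [this])).isCube
  convert this using 1
  ext v
  simp only [Set.mem_insert_iff, Set.mem_singleton_iff, Set.mem_range, Function.comp]
  constructor
  · rintro (rfl | rfl)
    · exact ⟨fun _ => x i, by simp⟩
    · exact ⟨fun _ => !(x i), rfl⟩
  · rintro ⟨b, rfl⟩
    by_cases hb : b 0 = x i
    · left; simp [hb]
    · right
      have : b 0 = !(x i) := by revert hb; cases b 0 <;> cases x i <;> simp
      rw [this]; rfl

/-- The edge is a face with two vertices. A direction in which these differ is free in the face, so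
the flip of `x` in it lies in the face and must be the other vertex. -/
lemma _root_.IsCubeChart.eq_flipAt_of_adj {C : Set V} {q : ℕ} {φ : (Fin q → Bool) → V}
    (h : IsCubeChart X.cubes C φ) {x : Fin q → Bool} {v : V} (hv : v ∈ C)
    (hadj : X.oneSkeleton.Adj (φ x) v) : ∃ i, v = φ (flipAt x i) := by
  obtain ⟨y, rfl⟩ := h.exists_eq hv
  obtain ⟨s, a, hs⟩ := (h.2.2 {φ x, φ y} (by
    rintro _ (rfl | rfl)
    exacts [h.mem x, h.mem y])).1 hadj.2.1
  have hx : x ∈ {x : Fin q → Bool | ∀ i ∈ s, x i = a i} := by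
    rw [← h.1.mem_set_image, ← hs]; simp
  have hy : y ∈ {x : Fin q → Bool | ∀ i ∈ s, x i = a i} := by
    rw [← h.1.mem_set_image, ← hs]; simp
  obtain ⟨i, hi⟩ := Function.ne_iff.1 (fun e : x = y => hadj.1 (e ▸ rfl))
  have his : i ∉ s := fun k => hi ((hx i k).trans (hy i k).symm)
  have hf : φ (flipAt x i) ∈ ({φ x, φ y} : Set V) := by
    rw [hs]
    refine ⟨_, fun k hk => ?_, rfl⟩
    rw [flipAt_of_ne _ (by rintro rfl; exact his hk)]
    exact hx k hk
  refine ⟨i, ?_⟩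
  rcases hf with hf | hf
  · exact absurd (h.1 hf) (flipAt_ne x i)
  · exact (show φ (flipAt x i) = φ y from hf).symm

/-- A cube that contains a corner of another cube contains that cube. -/
lemma _root_.IsCubeChart.subset_of_corner {C D : Set V} {q : ℕ} {φ : (Fin q → Bool) → V}
    (h : IsCubeChart X.cubes C φ) (hD : D ∈ X.cubes) (x : Fin q → Bool) (hx : φ x ∈ D)
    (hf : ∀ i, φ (flipAt x i) ∈ D) : C ⊆ D := by
  obtain ⟨s, a, hs⟩ := (h.2.2 (C ∩ D) Set.inter_subset_left).1
    (X.inter_mem C h.mem_cubes D hD ⟨φ x, h.mem x, hx⟩)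
  have hmem : ∀ y, φ y ∈ D → ∀ i ∈ s, y i = a i := fun y hy => by
    have : φ y ∈ C ∩ D := ⟨h.mem y, hy⟩
    rw [hs, h.1.mem_set_image] at this
    exact this
  -- A direction fixed by the face `C ∩ D` would exclude the neighbour of `x` in that direction.
  have hempty : ∀ i, i ∉ s := fun i hi => by
    have h1 := hmem x hx i hi
    have h2 := hmem _ (hf i) i hi
    simp [h1] at h2
  intro v hv
  obtain ⟨y, rfl⟩ := h.exists_eq hv
  have : φ y ∈ C ∩ D := by
    rw [hs, h.1.mem_set_image]
    exact fun i hi => absurd hi (hempty i)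
  exact this.2

/-! ### Squares -/

/-- `a`, `b`, `c`, `d` are the vertices of a square of `X`, in cyclic order. -/
structure Sq (X : CubeComplex V) (a b c d : V) : Prop where
  ab : X.oneSkeleton.Adj a b
  bc : X.oneSkeleton.Adj b c
  cd : X.oneSkeleton.Adj c d
  da : X.oneSkeleton.Adj d a
  cube : X.IsCube 2 {a, b, c, d}

namespace Sq

variable {a b c d : V}

lemma rotate (h : X.Sq a b c d) : X.Sq b c d a :=
  ⟨h.bc, h.cd, h.da, h.ab, by
    have := h.cube
    convert this using 1
    ext v; simp only [Set.mem_insert_iff, Set.mem_singleton_iff]; tauto⟩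

lemma rotateRight (h : X.Sq a b c d) : X.Sq d a b c := h.rotate.rotate.rotate

lemma reflect (h : X.Sq a b c d) : X.Sq a d c b :=
  ⟨h.da.symm, h.cd.symm, h.bc.symm, h.ab.symm, by
    have := h.cube
    convert this using 1
    ext v; simp only [Set.mem_insert_iff, Set.mem_singleton_iff]; tauto⟩

lemma ne (h : X.Sq a b c d) : a ≠ c := by
  rintro rfl
  obtain ⟨_, φ, hφ⟩ := h.cube
  have h1 := hφ.ncard
  have : ({a, b, a, d} : Set V) = {a, b, d} := by
    ext v; simp only [Set.mem_insert_iff, Set.mem_singleton_iff]; tauto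
  rw [this] at h1
  have h2 : ({a, b, d} : Set V).ncard ≤ 3 := by
    have := Set.ncard_insert_le a {b, d}
    have := Set.ncard_insert_le b {d}
    rw [Set.ncard_singleton] at this
    omega
  omega

lemma ne' (h : X.Sq a b c d) : b ≠ d := h.rotate.ne

end Sq

lemma _root_.IsCubeChart.sq {C : Set V} {q : ℕ} {φ : (Fin q → Bool) → V}
    (h : IsCubeChart X.cubes C φ) (x : Fin q → Bool) {i j : Fin q} (hij : i ≠ j) :
    X.Sq (φ x) (φ (flipAt x i)) (φ (flipAt (flipAt x i) j)) (φ (flipAt x j)) := by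
  refine ⟨h.adj_flipAt x i, h.adj_flipAt _ j, ?_, (h.adj_flipAt x j).symm, ?_⟩
  · rw [flipAt_comm]; exact (h.adj_flipAt _ i).symm
  have := (h.restrict (fun b : Fin 2 → Bool => Function.update (Function.update x i (b 0)) j (b 1))
    ![i, j] (fun b k => by fin_cases k <;> simp [hij])
    (fun b b' k hk => by
      have h1 : k ≠ i := fun h => hk ⟨0, h.symm⟩
      have h2 : k ≠ j := fun h => hk ⟨1, h.symm⟩
      simp [h1, h2])).isCube
  convert this using 1
  have hji := hij.symm
  ext v
  simp only [Set.mem_insert_iff, Set.mem_singleton_iff, Set.mem_range, Function.comp]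
  constructor
  · rintro (rfl | rfl | rfl | rfl)
    · exact ⟨![x i, x j], by simp⟩
    · exact ⟨![!(x i), x j], by congr 1; funext k; by_cases hk : k = j <;> simp_all [flipAt]⟩
    · exact ⟨![!(x i), !(x j)], by congr 1; simp [flipAt, hji]⟩
    · exact ⟨![x i, !(x j)], by simp [flipAt]⟩
  · rintro ⟨b, rfl⟩
    have hb : ∀ k l, b k = x l ∨ b k = !(x l) := fun k l => by
      cases b k <;> cases x l <;> simp
    rcases hb 0 i with h0 | h0 <;> rcases hb 1 j with h1 | h1
    · left; simp [h0, h1]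
    · right; right; right; simp [h0, h1, flipAt]
    · right; left; congr 1; funext k; by_cases hk : k = j <;> simp_all [flipAt]
    · right; right; left; congr 1; simp [h0, h1, flipAt, hji]

lemma exists_sq_of_isCube {C : Set V} {q : ℕ} (hC : X.IsCube q C) {v a b : V} (hv : v ∈ C)
    (ha : a ∈ C) (hb : b ∈ C) (hva : X.oneSkeleton.Adj v a) (hvb : X.oneSkeleton.Adj v b)
    (hab : a ≠ b) : ∃ c, X.Sq v a c b := by
  obtain ⟨_, φ, h⟩ := hC
  obtain ⟨x, rfl⟩ := h.exists_eq hv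
  obtain ⟨i, rfl⟩ := h.eq_flipAt_of_adj ha hva
  obtain ⟨j, rfl⟩ := h.eq_flipAt_of_adj hb hvb
  exact ⟨_, h.sq x (fun e => hab (e ▸ rfl))⟩

lemma Sq.exists_chart {a b c d : V} (h : X.Sq a b c d) :
    ∃ (φ : (Fin 2 → Bool) → V) (x : Fin 2 → Bool), IsCubeChart X.cubes {a, b, c, d} φ ∧
      φ x = a ∧ ∀ k, φ (flipAt x k) = b ∨ φ (flipAt x k) = d := by
  obtain ⟨_, φ, hφ⟩ := h.cube
  obtain ⟨x, hx⟩ := hφ.exists_eq (v := a) (by simp)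
  obtain ⟨i, hi⟩ := hφ.eq_flipAt_of_adj (x := x) (v := b) (by simp) (hx ▸ h.ab)
  obtain ⟨j, hj⟩ := hφ.eq_flipAt_of_adj (x := x) (v := d) (by simp) (hx ▸ h.da.symm)
  refine ⟨φ, x, hφ, hx, fun k => ?_⟩
  have hij : i ≠ j := fun e => h.ne' (by rw [hi, hj, e])
  have : k = i ∨ k = j := by omega
  rcases this with rfl | rfl
  · exact Or.inl hi.symm
  · exact Or.inr hj.symm

/-- Two adjacent edges determine a square that contains them. -/
lemma Sq.unique {a b c c' d : V} (h : X.Sq a b c d) (h' : X.Sq a b c' d) : c = c' := by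
  obtain ⟨φ, x, hφ, hx, hk⟩ := h.exists_chart
  have hsub := hφ.subset_of_corner h'.cube.1 x (by simp [hx])
    (fun k => by rcases hk k with e | e <;> simp [e])
  have hc : c ∈ ({a, b, c', d} : Set V) := hsub (by simp)
  rcases hc with rfl | rfl | hc | hc
  · exact absurd rfl h.ne
  · exact absurd h.bc (X.oneSkeleton.loopless.irrefl _)
  · exact hc
  · have : c = d := hc
    exact absurd h.cd (this ▸ X.oneSkeleton.loopless.irrefl _)

/-- Three squares around a corner are three faces of a cube. -/
lemma HasFlagLinks.exists_cube (hX : X.HasFlagLinks) {w x y z xy xz yz : V}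
    (hxy : X.Sq w x xy y) (hxz : X.Sq w x xz z) (hyz : X.Sq w y yz z) :
    ∃ r, X.Sq x xy r xz ∧ X.Sq y xy r yz ∧ X.Sq z xz r yz := by
  classical
  have hc : ({x, y, z} : Finset V).card = 3 :=
    Finset.card_eq_three.2 ⟨x, y, z, hxy.ne', hxz.ne', hyz.ne', rfl⟩
  obtain ⟨C, hC, hw, hS⟩ := hX w {x, y, z}
    (by
      simp only [Finset.mem_insert, Finset.mem_singleton]
      rintro a (rfl | rfl | rfl)
      exacts [hxy.ab, hyz.ab, hyz.da.symm])
    (by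
      simp only [Finset.mem_insert, Finset.mem_singleton]
      rintro a (rfl | rfl | rfl) b (rfl | rfl | rfl) hne
      · exact absurd rfl hne
      · exact ⟨_, hxy.cube, by simp, by simp, by simp⟩
      · exact ⟨_, hxz.cube, by simp, by simp, by simp⟩
      · exact ⟨_, hxy.cube, by simp, by simp, by simp⟩
      · exact absurd rfl hne
      · exact ⟨_, hyz.cube, by simp, by simp, by simp⟩
      · exact ⟨_, hxz.cube, by simp, by simp, by simp⟩
      · exact ⟨_, hyz.cube, by simp, by simp, by simp⟩
      · exact absurd rfl hne)
  have hx : x ∈ C := hS (by simp)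
  have hy : y ∈ C := hS (by simp)
  have hz : z ∈ C := hS (by simp)
  rw [hc] at hC
  clear hS hc
  obtain ⟨_, φ, h⟩ := hC
  obtain ⟨p, rfl⟩ := h.exists_eq hw
  obtain ⟨i, rfl⟩ := h.eq_flipAt_of_adj hx hxy.ab
  obtain ⟨j, rfl⟩ := h.eq_flipAt_of_adj hy hyz.ab
  obtain ⟨k, rfl⟩ := h.eq_flipAt_of_adj hz hyz.da.symm
  have hij : i ≠ j := fun e => hxy.ne' (by rw [e])
  have hik : i ≠ k := fun e => hxz.ne' (by rw [e])
  have hjk : j ≠ k := fun e => hyz.ne' (by rw [e])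
  -- Two adjacent edges determine their square, so the given squares are faces of this cube.
  obtain rfl := hxy.unique (h.sq p hij)
  obtain rfl := hxz.unique (h.sq p hik)
  obtain rfl := hyz.unique (h.sq p hjk)
  refine ⟨φ (flipAt (flipAt (flipAt p i) j) k), h.sq (flipAt p i) hjk, ?_, ?_⟩
  · rw [flipAt_comm p i j]; exact h.sq (flipAt p j) hik
  · rw [flipAt_comm p i k, flipAt_comm p j k, flipAt_comm (flipAt p i) j k, flipAt_comm p i k]
    exact h.sq (flipAt p k) hij

/-! ### Edge paths up to pushing across squares

An edge path is recorded by the list of its vertices, last vertex first. -/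

/-- Pushing an edge path across a square. -/
inductive SquareSwap (X : CubeComplex V) : List V → List V → Prop
  | square {a b c d : V} (l : List V) (h : X.Sq a b c d) :
      SquareSwap X (c :: b :: a :: l) (c :: d :: a :: l)
  | cons (x : V) {l l' : List V} (h : SquareSwap X l l') : SquareSwap X (x :: l) (x :: l')

lemma SquareSwap.symm {l l' : List V} (h : X.SquareSwap l l') : X.SquareSwap l' l := by
  induction h with
  | square l h => exact .square l h.reflect
  | cons x _ ih => exact .cons x ih

/-- The equivalence relation generated by pushing edge paths across squares. -/
def SwapEquiv (X : CubeComplex V) : List V → List V → Prop := Relation.ReflTransGen X.SquareSwap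

namespace SwapEquiv

variable {l l' l'' : List V}

lemma refl (l : List V) : X.SwapEquiv l l := Relation.ReflTransGen.refl

lemma trans (h : X.SwapEquiv l l') (h' : X.SwapEquiv l' l'') : X.SwapEquiv l l'' :=
  Relation.ReflTransGen.trans h h'

lemma symm (h : X.SwapEquiv l l') : X.SwapEquiv l' l := by
  induction h with
  | refl => exact refl _
  | tail _ h ih => exact (Relation.ReflTransGen.single h.symm).trans ih

lemma cons (x : V) (h : X.SwapEquiv l l') : X.SwapEquiv (x :: l) (x :: l') := by
  induction h with
  | refl => exact refl _
  | tail _ h ih => exact ih.tail (.cons x h)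

lemma square {a b c d : V} (l : List V) (h : X.Sq a b c d) :
    X.SwapEquiv (c :: b :: a :: l) (c :: d :: a :: l) :=
  Relation.ReflTransGen.single (.square l h)

lemma length_eq (h : X.SwapEquiv l l') : l.length = l'.length := by
  induction h with
  | refl => rfl
  | tail _ h ih =>
    rw [ih]
    clear ih
    rename_i hl
    clear hl
    induction h with
    | square l h => rfl
    | cons x h ih => simp [ih]

lemma head_eq {a b : V} (h : X.SwapEquiv (a :: l) (b :: l')) : a = b := by
  suffices ∀ p, X.SwapEquiv (a :: l) p → ∃ m, p = a :: m by
    obtain ⟨m, hm⟩ := this _ h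
    exact (List.cons.inj hm).1.symm
  intro p hp
  induction hp with
  | refl => exact ⟨l, rfl⟩
  | tail _ h ih =>
    obtain ⟨m, rfl⟩ := ih
    cases h with
    | square l h => exact ⟨_, rfl⟩
    | cons x h => exact ⟨_, rfl⟩

/-- Two equivalent edge paths with different last edges span a square at their endpoint, and
are equivalent to edge paths that run through the opposite vertex of this square. -/
theorem eq_or_square (hX : X.HasFlagLinks) {z : V} {m m' : List V}
    (h : X.SwapEquiv (z :: m) (z :: m')) :
    X.SwapEquiv m m' ∨ ∃ u x w δ, X.Sq z u x w ∧ X.SwapEquiv m (u :: x :: δ) ∧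
      X.SwapEquiv m' (w :: x :: δ) := by
  induction hn : m.length using Nat.strong_induction_on generalizing z m m' with
  -- The outer induction is on the length of the path, the inner one on the number of swaps.
  | _ n ih =>
  suffices ∀ p, X.SwapEquiv (z :: m) p → ∃ m', p = z :: m' ∧
      (X.SwapEquiv m m' ∨ ∃ u x w δ, X.Sq z u x w ∧ X.SwapEquiv m (u :: x :: δ) ∧
        X.SwapEquiv m' (w :: x :: δ)) by
    obtain ⟨m₁, h₁, h₂⟩ := this _ h
    obtain rfl := (List.cons.inj h₁).2
    exact h₂
  intro p hp
  induction hp with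
  | refl => exact ⟨m, rfl, Or.inl (refl _)⟩
  | tail _ hs ih' =>
    obtain ⟨m₂, rfl, h₂⟩ := ih'
    cases hs with
    | cons _ hs =>
      refine ⟨_, rfl, ?_⟩
      rcases h₂ with h₂ | ⟨u, x, w, δ, hsq, hu, hw⟩
      · exact Or.inl (h₂.tail hs)
      · exact Or.inr ⟨u, x, w, δ, hsq, hu, (Relation.ReflTransGen.single hs.symm).trans hw⟩
    | @square y w _ t ε hsq' =>
      have hsq' := hsq'.rotate.rotate.reflect
      refine ⟨_, rfl, ?_⟩
      rcases h₂ with h₂ | ⟨u, x, w', δ, hsq, hu, hw⟩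
      · exact Or.inr ⟨w, y, t, ε, hsq', h₂, refl _⟩
      obtain rfl := hw.head_eq
      have hlen : (y :: ε).length < n := by
        have h1 := hu.length_eq
        have h2 := hw.length_eq
        simp only [List.length_cons] at *
        omega
      -- Two squares at `z` now share the edge to `w`. Exchange for the shorter paths ending at `w`
      -- shows either that the squares coincide or that a third square at `w` completes them to a
      -- corner of a 3-cube; its vertex `r` opposite to `w` is the one sought.
      rcases ih _ hlen hw rfl with h₃ | ⟨y', s, x', η, hs, hy, hx⟩
      · obtain rfl := h₃.head_eq
        obtain rfl := hsq.rotateRight.unique hsq'.rotate.reflect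
        exact Or.inl (hu.trans (h₃.symm.cons u))
      · obtain rfl := hy.head_eq
        obtain rfl := hx.head_eq
        obtain ⟨r, h1, h2, h3⟩ := hX.exists_cube hsq.rotateRight hsq'.rotate.reflect hs.reflect
        right
        refine ⟨u, r, t, s :: η, h1, ?_, ?_⟩
        · refine (hu.trans (hx.cons u)).trans (square _ ?_)
          exact h2.rotateRight
        · refine (hy.cons t).trans (square _ ?_)
          exact h3.rotateRight

end SwapEquiv

/-! ### Reduced edge paths -/

/-- The edge paths from `P` that are not equivalent to an edge path with a backtrack. -/
inductive IsReduced (X : CubeComplex V) (P : V) : List V → Prop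
  | nil : IsReduced X P [P]
  | cons {z v : V} {l : List V} (h : IsReduced X P (z :: l)) (hzv : X.oneSkeleton.Adj z v)
      (hl : ∀ δ, ¬ X.SwapEquiv (z :: l) (z :: v :: δ)) : IsReduced X P (v :: z :: l)

namespace IsReduced

variable {P : V}

/-- The critical case is a swap of the last two edges: by exchange and uniqueness of squares, a
backtrack after the swap produces one before it. -/
lemma of_swapEquiv (hX : X.HasFlagLinks) {p p' : List V} (h : X.IsReduced P p)
    (hp : X.SwapEquiv p p') : X.IsReduced P p' := by
  suffices ∀ p, X.IsReduced P p → ∀ p', X.SquareSwap p p' → X.IsReduced P p' by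
    induction hp with
    | refl => exact h
    | tail _ h ih => exact this _ ih _ h
  clear hp h
  intro p h
  induction h with
  | nil => rintro _ (_ | @⟨_, _, _, ⟨⟩⟩)
  | @cons z v l h hzv hl ih =>
    intro p' hs
    cases hs with
    | @square a _ _ d l hsq =>
      cases h with
      | cons h haz hl' =>
      refine cons (cons h hsq.da.symm fun ε hε => ?_) hsq.cd.symm fun ε hε => ?_
      · exact hl _ ((hε.cons z).trans (.square _ hsq.rotateRight))
      · rcases hε.eq_or_square hX with h1 | ⟨u, s, w, η, hsq', hu, hw⟩
        · exact hsq.ne h1.head_eq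
        · obtain rfl := hu.head_eq
          obtain rfl := hw.head_eq
          obtain rfl := hsq'.unique hsq.rotateRight
          exact hl' _ hu
    | cons _ hs =>
      have hs' := hs
      -- Both cases are alike; the split only exposes that the swapped list still begins with `z`.
      cases hs with
      | square l hsq =>
        exact cons (ih _ hs') hzv fun δ hδ => hl δ ((Relation.ReflTransGen.single hs').trans hδ)
      | cons _ hs =>
        exact cons (ih _ hs') hzv fun δ hδ => hl δ ((Relation.ReflTransGen.single hs').trans hδ)

lemma not_swapEquiv {v z : V} {l : List V} (h : X.IsReduced P (v :: z :: l)) (δ : List V) :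
    ¬ X.SwapEquiv (z :: l) (z :: v :: δ) := by
  cases h with
  | cons _ _ hl => exact hl δ

lemma tail {v z : V} {l : List V} (h : X.IsReduced P (v :: z :: l)) : X.IsReduced P (z :: l) := by
  cases h with
  | cons h _ _ => exact h

lemma exists_walk {z : V} {l : List V} (h : X.IsReduced P (z :: l)) :
    ∃ p : X.oneSkeleton.Walk P z, p.length = l.length := by
  generalize hm : z :: l = m at h
  induction h generalizing z l with
  | nil =>
    obtain ⟨rfl, rfl⟩ := List.cons.inj hm
    exact ⟨.nil, rfl⟩
  | cons _ hzv _ ih =>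
    obtain ⟨rfl, rfl⟩ := List.cons.inj hm
    obtain ⟨p, hp⟩ := ih rfl
    exact ⟨p.concat hzv, by simp [hp]⟩

end IsReduced

/-! ### The action of walks on classes of reduced edge paths -/

open Classical in
/-- Extend an edge path by the edge to `v`, and cancel this edge against the last edge of an
equivalent edge path if possible. -/
noncomputable def extend (X : CubeComplex V) (γ : List V) (v : V) : List V :=
  if h : ∃ p : V × List V, X.SwapEquiv γ (p.1 :: v :: p.2) then v :: h.choose.2 else v :: γ

section extend

variable {P : V}

lemma exists_extend_eq (γ : List V) (v : V) : ∃ l, X.extend γ v = v :: l := by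
  unfold extend; split_ifs <;> exact ⟨_, rfl⟩

/-- The choice made in `extend` is harmless: for two paths with the same last edge, the square
alternative of exchange would be degenerate. -/
lemma extend_of_swapEquiv (hX : X.HasFlagLinks) {γ δ : List V} {z v : V}
    (h : X.SwapEquiv γ (z :: v :: δ)) : X.SwapEquiv (X.extend γ v) (v :: δ) := by
  have h' : ∃ p : V × List V, X.SwapEquiv γ (p.1 :: v :: p.2) := ⟨(z, δ), h⟩
  rw [extend, dif_pos h']
  have h₁ := h'.choose_spec.symm.trans h
  obtain hz := h₁.head_eq
  rw [hz] at h₁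
  rcases h₁.eq_or_square hX with h₂ | ⟨u, x, w, ε, hsq, hu, hw⟩
  · exact h₂
  · exact absurd (hu.head_eq.symm.trans hw.head_eq) hsq.ne'

lemma extend_of_not {l : List V} {z v : V}
    (h : ∀ δ, ¬ X.SwapEquiv (z :: l) (z :: v :: δ)) : X.extend (z :: l) v = v :: z :: l := by
  rw [extend, dif_neg]
  rintro ⟨⟨y, δ⟩, hp⟩
  obtain rfl := hp.head_eq
  exact h δ hp

lemma extend_congr (hX : X.HasFlagLinks) {γ γ' : List V} (h : X.SwapEquiv γ γ') (v : V) :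
    X.SwapEquiv (X.extend γ v) (X.extend γ' v) := by
  by_cases hp : ∃ p : V × List V, X.SwapEquiv γ' (p.1 :: v :: p.2)
  · obtain ⟨⟨z, δ⟩, hp⟩ := hp
    exact (extend_of_swapEquiv hX (h.trans hp)).trans (extend_of_swapEquiv hX hp).symm
  · have hp' : ¬ ∃ p : V × List V, X.SwapEquiv γ (p.1 :: v :: p.2) :=
      fun ⟨p, h'⟩ => hp ⟨p, h.symm.trans h'⟩
    rw [extend, dif_neg hp', extend, dif_neg hp]
    exact h.cons v

lemma IsReduced.extend (hX : X.HasFlagLinks) {z v : V} {l : List V}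
    (h : X.IsReduced P (z :: l)) (hzv : X.oneSkeleton.Adj z v) :
    X.IsReduced P (X.extend (z :: l) v) := by
  by_cases hp : ∃ δ, X.SwapEquiv (z :: l) (z :: v :: δ)
  · obtain ⟨δ, hδ⟩ := hp
    exact (h.of_swapEquiv hX hδ).tail.of_swapEquiv hX (extend_of_swapEquiv hX hδ).symm
  · rw [extend_of_not (not_exists.1 hp)]
    exact .cons h hzv (not_exists.1 hp)

/-- If the first step cancels an edge, reducedness keeps the second from cancelling; otherwise the
second cancels the first. -/
lemma extend_backtrack (hX : X.HasFlagLinks) {z v : V} {l : List V}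
    (h : X.IsReduced P (z :: l)) :
    X.SwapEquiv (X.extend (X.extend (z :: l) v) z) (z :: l) := by
  by_cases hp : ∃ δ, X.SwapEquiv (z :: l) (z :: v :: δ)
  · obtain ⟨δ, hδ⟩ := hp
    have h₁ := extend_congr hX (extend_of_swapEquiv hX hδ) z
    rw [extend_of_not (h.of_swapEquiv hX hδ).not_swapEquiv] at h₁
    exact h₁.trans hδ.symm
  · rw [extend_of_not (not_exists.1 hp)]
    exact extend_of_swapEquiv hX (.refl _)

/-- The step to `a` cancels and the step to `b` does not. Both routes then end in the class of `c ::
a :: δ`, the second after a push across the square. -/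
lemma extend_square_aux (hX : X.HasFlagLinks) {z a b c : V} {l δ : List V}
    (hsq : X.Sq z a c b) (ha : X.SwapEquiv (z :: l) (z :: a :: δ))
    (hb : ∀ δ, ¬ X.SwapEquiv (z :: l) (z :: b :: δ)) :
    X.SwapEquiv (X.extend (X.extend (z :: l) a) c) (X.extend (X.extend (z :: l) b) c) := by
  have h₁ := extend_congr hX (extend_of_swapEquiv hX ha) c
  have h₂ : ∀ ε, ¬ X.SwapEquiv (a :: δ) (a :: c :: ε) := fun ε hε =>
    hb _ ((ha.trans (hε.cons z)).trans (.square _ hsq.rotate.rotate.reflect))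
  have h₃ : X.SwapEquiv (b :: z :: l) (b :: c :: a :: δ) :=
    (ha.cons b).trans (.square δ hsq.rotate.reflect)
  rw [extend_of_not h₂] at h₁
  rw [extend_of_not hb]
  exact h₁.trans (extend_of_swapEquiv hX h₃).symm

/-- If both first steps cancel, exchange shows that the path came through `c`, and both routes go
back there. If neither does, exchange shows that the second steps do not cancel either, and the two
results differ by one swap. -/
lemma extend_square (hX : X.HasFlagLinks) {z a b c : V} {l : List V} (hsq : X.Sq z a c b) :
    X.SwapEquiv (X.extend (X.extend (z :: l) a) c) (X.extend (X.extend (z :: l) b) c) := by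
  by_cases ha : ∃ δ, X.SwapEquiv (z :: l) (z :: a :: δ) <;>
  by_cases hb : ∃ δ, X.SwapEquiv (z :: l) (z :: b :: δ)
  · obtain ⟨δ, ha⟩ := ha
    obtain ⟨δ', hb⟩ := hb
    rcases (ha.symm.trans hb).eq_or_square hX with h | ⟨u, s, w, η, hsq', hu, hw⟩
    · exact absurd h.head_eq hsq.ne'
    · obtain rfl := hu.head_eq
      obtain rfl := hw.head_eq
      obtain rfl := hsq.unique hsq'
      exact (extend_of_swapEquiv hX ((extend_of_swapEquiv hX ha).trans hu)).trans
        (extend_of_swapEquiv hX ((extend_of_swapEquiv hX hb).trans hw)).symm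
  · obtain ⟨δ, ha⟩ := ha
    exact extend_square_aux hX hsq ha (not_exists.1 hb)
  · obtain ⟨δ, hb⟩ := hb
    exact (extend_square_aux hX hsq.reflect hb (not_exists.1 ha)).symm
  · have key : ∀ a b, X.Sq z a c b → (∀ δ, ¬ X.SwapEquiv (z :: l) (z :: b :: δ)) →
        ∀ δ, ¬ X.SwapEquiv (a :: z :: l) (a :: c :: δ) := by
      intro a b hsq hb δ hδ
      rcases hδ.eq_or_square hX with h | ⟨u, s, w, η, hsq', hu, hw⟩
      · exact hsq.ne h.head_eq
      · obtain rfl := hu.head_eq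
        obtain rfl := hw.head_eq
        obtain rfl := hsq.reflect.rotateRight.unique hsq'
        exact hb _ hu
    rw [extend_of_not (not_exists.1 ha), extend_of_not (not_exists.1 hb),
      extend_of_not (key a b hsq (not_exists.1 hb)),
      extend_of_not (key b a hsq.reflect (not_exists.1 ha))]
    exact .square _ hsq

end extend

/-- Extend an edge path successively by the edges of a walk. -/
noncomputable def extendWalk (X : CubeComplex V) :
    List V → ∀ {u v : V}, X.oneSkeleton.Walk u v → List V
  | γ, _, _, .nil => γ
  | γ, _, _, .cons (v := v) _ p => X.extendWalk (X.extend γ v) p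

section extendWalk

variable {P : V}

lemma extendWalk_nil (γ : List V) (u : V) :
    X.extendWalk γ (.nil : X.oneSkeleton.Walk u u) = γ := rfl

lemma extendWalk_cons (γ : List V) {u v w : V} (h : X.oneSkeleton.Adj u v)
    (p : X.oneSkeleton.Walk v w) :
    X.extendWalk γ (.cons h p) = X.extendWalk (X.extend γ v) p := rfl

lemma extendWalk_append (γ : List V) {u v w : V} (p : X.oneSkeleton.Walk u v)
    (r : X.oneSkeleton.Walk v w) :
    X.extendWalk γ (p.append r) = X.extendWalk (X.extendWalk γ p) r := by
  induction p generalizing γ with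
  | nil => rfl
  | cons h p ih => simp only [SimpleGraph.Walk.cons_append, extendWalk_cons, ih]

lemma extendWalk_congr (hX : X.HasFlagLinks) {γ γ' : List V} (h : X.SwapEquiv γ γ') {u v : V}
    (p : X.oneSkeleton.Walk u v) : X.SwapEquiv (X.extendWalk γ p) (X.extendWalk γ' p) := by
  induction p generalizing γ γ' with
  | nil => exact h
  | cons _ p ih => exact ih (extend_congr hX h _)

lemma IsReduced.extendWalk (hX : X.HasFlagLinks) {u v : V} (p : X.oneSkeleton.Walk u v)
    {l : List V} (h : X.IsReduced P (u :: l)) :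
    ∃ l', X.extendWalk (u :: l) p = v :: l' ∧ X.IsReduced P (v :: l') := by
  induction p generalizing l with
  | nil => exact ⟨l, rfl, h⟩
  | @cons u w v huw p ih =>
    obtain ⟨l', hl'⟩ := exists_extend_eq (X := X) (u :: l) w
    have := h.extend hX huw
    rw [hl'] at this
    rw [extendWalk_cons, hl']
    exact ih this

lemma extendWalk_reverse (hX : X.HasFlagLinks) {u v : V} (p : X.oneSkeleton.Walk u v)
    {l : List V} (h : X.IsReduced P (u :: l)) :
    X.SwapEquiv (X.extendWalk (X.extendWalk (u :: l) p) p.reverse) (u :: l) := by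
  induction p generalizing l with
  | nil => exact .refl _
  | @cons u w v huw p ih =>
    obtain ⟨l', hl'⟩ := exists_extend_eq (X := X) (u :: l) w
    have := h.extend hX huw
    rw [hl'] at this
    rw [extendWalk_cons _ huw, SimpleGraph.Walk.reverse_cons, extendWalk_append, hl']
    refine (extendWalk_congr hX (ih this) _).trans ?_
    rw [extendWalk_cons, extendWalk_nil, ← hl']
    exact extend_backtrack hX h

lemma extendWalk_elemHomotopy (hX : X.HasFlagLinks) {u v : V} {p p' : X.oneSkeleton.Walk u v}
    (hp : X.ElemHomotopy p p') {l : List V} (h : X.IsReduced P (u :: l)) :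
    X.SwapEquiv (X.extendWalk (u :: l) p) (X.extendWalk (u :: l) p') := by
  cases hp with
  | backtrack p hab r =>
    obtain ⟨l', hl', h'⟩ := h.extendWalk hX p
    simp only [extendWalk_append, extendWalk_cons, hl']
    exact extendWalk_congr hX (extend_backtrack hX h').symm r
  | square p hab hbc had hdc hsq r =>
    obtain ⟨l', hl', h'⟩ := h.extendWalk hX p
    simp only [extendWalk_append, extendWalk_cons, hl']
    exact extendWalk_congr hX (extend_square hX ⟨hab, hbc, hdc.symm, had.symm, hsq⟩) r

lemma extendWalk_homotopy (hX : X.HasFlagLinks) {u v : V} {p p' : X.oneSkeleton.Walk u v}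
    (hp : Relation.EqvGen X.ElemHomotopy p p') {l : List V} (h : X.IsReduced P (u :: l)) :
    X.SwapEquiv (X.extendWalk (u :: l) p) (X.extendWalk (u :: l) p') := by
  induction hp with
  | rel _ _ hp => exact extendWalk_elemHomotopy hX hp h
  | refl => exact .refl _
  | symm _ _ _ ih => exact ih.symm
  | trans _ _ _ _ _ ih₁ ih₂ => exact ih₁.trans ih₂

/-- Extending along a reduced path itself never cancels an edge. -/
lemma IsReduced.exists_extendWalk (hX : X.HasFlagLinks) {z : V} {l : List V}
    (h : X.IsReduced P (z :: l)) :
    ∃ p : X.oneSkeleton.Walk P z, X.SwapEquiv (X.extendWalk [P] p) (z :: l) := by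
  generalize hm : z :: l = m at h
  induction h generalizing z l with
  | nil =>
    obtain ⟨rfl, rfl⟩ := List.cons.inj hm
    exact ⟨.nil, .refl _⟩
  | cons _ hzv hl ih =>
    obtain ⟨rfl, rfl⟩ := List.cons.inj hm
    obtain ⟨p, hp⟩ := ih rfl
    refine ⟨p.append (.cons hzv .nil), ?_⟩
    rw [extendWalk_append, extendWalk_cons, extendWalk_nil]
    have := extend_congr hX hp z
    rwa [extend_of_not hl] at this

/-- Reduced edge paths with the same endpoints are equivalent. -/
theorem IsReduced.swapEquiv (hX : X.IsCAT0) {z : V} {l l' : List V}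
    (h : X.IsReduced P (z :: l)) (h' : X.IsReduced P (z :: l')) :
    X.SwapEquiv (z :: l) (z :: l') := by
  obtain ⟨p, hp⟩ := h.exists_extendWalk hX.2
  obtain ⟨p', hp'⟩ := h'.exists_extendWalk hX.2
  -- The loop `p` followed by the reverse of `p'` acts trivially on `[P]`; acting by `p'` afterwards
  -- compares the two classes.
  have h₁ := extendWalk_homotopy hX.2 (hX.1.2 P (p.append p'.reverse)) (.nil (X := X))
  rw [extendWalk_append, extendWalk_nil] at h₁
  have h₂ := extendWalk_congr hX.2 h₁ p'
  obtain ⟨m, hm, hr⟩ := (IsReduced.nil (X := X) (P := P)).extendWalk hX.2 p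
  have h₃ := extendWalk_reverse hX.2 p'.reverse hr
  rw [SimpleGraph.Walk.reverse_reverse, ← hm] at h₃
  exact ((hp.symm.trans h₃.symm).trans h₂).trans hp'

end extendWalk

/-! ### The edge-path metric -/

lemma edgeDist_comm (P Q : V) : X.edgeDist P Q = X.edgeDist Q P := SimpleGraph.dist_comm

lemma edgeDist_self (P : V) : X.edgeDist P P = 0 := SimpleGraph.dist_self

lemma edgeDist_of_adj {P Q : V} (h : X.oneSkeleton.Adj P Q) : X.edgeDist P Q = 1 :=
  SimpleGraph.dist_eq_one_iff_adj.2 h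

namespace IsCAT0

lemma edgeDist_triangle (hX : X.IsCAT0) (P Q R : V) :
    X.edgeDist P R ≤ X.edgeDist P Q + X.edgeDist Q R := hX.1.1.dist_triangle

lemma eq_of_edgeDist (hX : X.IsCAT0) {P Q : V} (h : X.edgeDist P Q = 0) : P = Q :=
  hX.1.1.dist_eq_zero_iff.1 h

/-- Elementary homotopies preserve the parity of the length. Hence adjacent vertices are never
equidistant from `P`. -/
lemma even_length (hX : X.IsCAT0) {v : V} (p : X.oneSkeleton.Walk v v) : Even p.length := by
  suffices ∀ {u v : V} (p p' : X.oneSkeleton.Walk u v), Relation.EqvGen X.ElemHomotopy p p' →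
      (Even p.length ↔ Even p'.length) by
    rw [this p .nil (hX.1.2 v p)]; simp
  intro u v p p' h
  induction h with
  | rel _ _ h =>
    cases h with
    | backtrack p h r => simp [SimpleGraph.Walk.length_append, ← add_assoc, Nat.even_add_one]
    | square p _ _ _ _ _ r => simp [SimpleGraph.Walk.length_append]
  | refl => rfl
  | symm _ _ _ ih => exact ih.symm
  | trans _ _ _ _ _ ih₁ ih₂ => exact ih₁.trans ih₂

lemma edgeDist_adj (hX : X.IsCAT0) (P : V) {u v : V} (h : X.oneSkeleton.Adj u v) :
    X.edgeDist P u = X.edgeDist P v + 1 ∨ X.edgeDist P v = X.edgeDist P u + 1 := by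
  have h₁ := hX.edgeDist_triangle P u v
  have h₂ := hX.edgeDist_triangle P v u
  rw [edgeDist_of_adj h] at h₁
  rw [edgeDist_of_adj h.symm] at h₂
  have : X.edgeDist P u ≠ X.edgeDist P v := by
    intro he
    obtain ⟨p, hp⟩ := hX.1.1.exists_walk_length_eq_dist P u
    obtain ⟨p', hp'⟩ := hX.1.1.exists_walk_length_eq_dist P v
    have := hX.even_length (p.append (.cons h p'.reverse))
    simp only [SimpleGraph.Walk.length_append, SimpleGraph.Walk.length_cons,
      SimpleGraph.Walk.length_reverse, hp, hp'] at this
    change Even (X.edgeDist P u + (X.edgeDist P v + 1)) at this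
    rw [he, ← add_assoc, Nat.even_add_one] at this
    exact this (Even.add_self _)
  omega

lemma exists_adj_edgeDist (hX : X.IsCAT0) {P v : V} {n : ℕ} (h : X.edgeDist P v = n + 1) :
    ∃ u, X.oneSkeleton.Adj u v ∧ X.edgeDist P u = n := by
  obtain ⟨p, hp⟩ := hX.1.1.exists_walk_length_eq_dist v P
  change _ = X.edgeDist v P at hp
  rw [edgeDist_comm, h] at hp
  cases p with
  | nil => simp at hp
  | @cons _ u _ hadj p =>
    refine ⟨u, hadj.symm, ?_⟩
    have h₁ : X.edgeDist u P ≤ p.length := SimpleGraph.dist_le p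
    rw [edgeDist_comm] at h₁
    have h₂ := hX.edgeDist_triangle P u v
    rw [edgeDist_of_adj hadj.symm] at h₂
    simp at hp
    omega

/-- An equivalent path through `v` just before `u` would, without its last edge, be a walk to `v`
that is shorter than the distance. -/
lemma isReduced_cons (hX : X.IsCAT0) {P u v : V} {l : List V} (h : X.IsReduced P (u :: l))
    (hl : l.length = X.edgeDist P u) (huv : X.oneSkeleton.Adj u v)
    (hd : X.edgeDist P v = X.edgeDist P u + 1) : X.IsReduced P (v :: u :: l) := by
  refine .cons h huv fun δ hδ => ?_
  obtain ⟨p, hp⟩ := (h.of_swapEquiv hX.2 hδ).tail.exists_walk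
  have h₁ : X.edgeDist P v ≤ p.length := SimpleGraph.dist_le p
  have h₂ := hδ.length_eq
  simp only [List.length_cons] at h₂
  omega

lemma exists_isReduced (hX : X.IsCAT0) (P v : V) :
    ∃ l, X.IsReduced P (v :: l) ∧ l.length = X.edgeDist P v := by
  induction hn : X.edgeDist P v generalizing v with
  | zero =>
    obtain rfl := hX.eq_of_edgeDist hn
    exact ⟨[], .nil, rfl⟩
  | succ n ih =>
    obtain ⟨u, huv, hu⟩ := hX.exists_adj_edgeDist hn
    obtain ⟨l, hl, hlen⟩ := ih u hu
    exact ⟨u :: l, hX.isReduced_cons hl (hlen.trans hu.symm) huv (by omega), by simp [hlen]⟩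

/-- The quadrangle condition. -/
theorem quadrangle (hX : X.IsCAT0) {P z u w : V} (huz : X.oneSkeleton.Adj u z)
    (hwz : X.oneSkeleton.Adj w z) (hu : X.edgeDist P z = X.edgeDist P u + 1)
    (hw : X.edgeDist P z = X.edgeDist P w + 1) (huw : u ≠ w) :
    ∃ x, X.Sq z u x w ∧ X.edgeDist P u = X.edgeDist P x + 1 := by
  obtain ⟨l, hl, hlen⟩ := hX.exists_isReduced P u
  obtain ⟨l', hl', hlen'⟩ := hX.exists_isReduced P w
  -- Geodesics to `z` through `u` and through `w` are reduced, hence equivalent.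
  have h := (hX.isReduced_cons hl hlen huz hu).swapEquiv hX
    (hX.isReduced_cons hl' hlen' hwz hw)
  rcases h.eq_or_square hX.2 with h | ⟨u', x, w', δ, hsq, h₁, h₂⟩
  · exact absurd h.head_eq huw
  · obtain rfl := h₁.head_eq
    obtain rfl := h₂.head_eq
    refine ⟨x, hsq, ?_⟩
    obtain ⟨p, hp⟩ := (hl.of_swapEquiv hX.2 h₁).tail.exists_walk
    have h₃ : X.edgeDist P x ≤ p.length := SimpleGraph.dist_le p
    have h₄ := h₁.length_eq
    simp only [List.length_cons] at h₄
    rcases hX.edgeDist_adj P hsq.bc with h | h <;> omega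

end IsCAT0

/-! ### Descending to a nearest point -/

/-- The steps of `r` that decrease the distance of the vertex `f t` from `P`. -/
def Descends {T : Type*} (X : CubeComplex V) (P : V) (f : T → V) (r : T → T → Prop) (s t : T) :
    Prop := r s t ∧ X.edgeDist P (f s) = X.edgeDist P (f t) + 1

section Descends

variable {T : Type*} {P : V} {f : T → V} {r : T → T → Prop}

/-- The quadrangle condition closes any two descending steps from a common source by at most one
further step on each side, so having a common descendant is an equivalence relation. It contains
`r`, since an `r`-step descends in one direction or the other. -/
lemma IsCAT0.join_descends (hX : X.IsCAT0) (hsymm : ∀ s t, r s t → r t s)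
    (hadj : ∀ s t, r s t → X.oneSkeleton.Adj (f s) (f t))
    (hinj : ∀ s t t', r s t → r s t' → f t = f t' → t = t')
    (hsq : ∀ s t t' x, r s t → r s t' → X.Sq (f s) (f t) x (f t') →
      ∃ s', f s' = x ∧ r t s' ∧ r t' s')
    {s t : T} (h : Relation.ReflTransGen r s t) :
    Relation.Join (Relation.ReflTransGen (X.Descends P f r)) s t := by
  have hcr : ∀ a b c, X.Descends P f r a b → X.Descends P f r a c →
      ∃ d, Relation.ReflGen (X.Descends P f r) b d ∧
        Relation.ReflTransGen (X.Descends P f r) c d := by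
    rintro a b c ⟨hab, hb⟩ ⟨hac, hc⟩
    by_cases hbc : f b = f c
    · obtain rfl := hinj a b c hab hac hbc
      exact ⟨b, .refl, .refl⟩
    · obtain ⟨x, hx, hd⟩ := hX.quadrangle (hadj _ _ hab).symm (hadj _ _ hac).symm hb hc hbc
      obtain ⟨d, rfl, hbd, hcd⟩ := hsq a b c x hab hac hx
      exact ⟨d, .single ⟨hbd, hd⟩, .single ⟨hcd, by omega⟩⟩
  have heq := Relation.equivalence_join_reflTransGen hcr
  induction h with
  | refl => exact heq.refl _
  | @tail b c _ hbc ih =>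
    refine heq.trans ih ?_
    rcases hX.edgeDist_adj P (hadj _ _ hbc) with h | h
    · exact ⟨c, .single ⟨hbc, h⟩, .refl⟩
    · exact ⟨b, .refl, .single ⟨hsymm _ _ hbc, h⟩⟩

/-- A descending chain has as many edges as the distance from `P` drops, so it is geodesic and
extends a geodesic from `P`. -/
lemma IsCAT0.edgeDist_of_descends (hX : X.IsCAT0)
    (hadj : ∀ s t, r s t → X.oneSkeleton.Adj (f s) (f t)) {s t : T}
    (h : Relation.ReflTransGen (X.Descends P f r) s t) :
    X.edgeDist P (f s) = X.edgeDist P (f t) + X.edgeDist (f t) (f s) := by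
  suffices X.edgeDist P (f t) + X.edgeDist (f t) (f s) ≤ X.edgeDist P (f s) from
    le_antisymm (hX.edgeDist_triangle _ _ _) this
  induction h using Relation.ReflTransGen.head_induction_on with
  | refl => simp [edgeDist_self]
  | @head a b hab _ ih =>
    have h₁ := hX.edgeDist_triangle (f t) (f b) (f a)
    rw [edgeDist_of_adj (hadj _ _ hab.1).symm] at h₁
    have := hab.2
    omega

lemma eq_of_descends_of_le {s t : T} (h : Relation.ReflTransGen (X.Descends P f r) s t)
    (hd : X.edgeDist P (f s) ≤ X.edgeDist P (f t)) : s = t := by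
  have key : ∀ t, Relation.ReflTransGen (X.Descends P f r) s t →
      X.edgeDist P (f t) ≤ X.edgeDist P (f s) := by
    intro t h
    induction h with
    | refl => rfl
    | tail _ h ih => have := h.2; omega
  cases h with
  | refl => rfl
  | tail h h' =>
    have := key _ h
    have := h'.2
    omega

end Descends

/-! ### Convex sets of vertices -/

/-- `R` is the gate of `P` in `N`. -/
def IsGate (X : CubeComplex V) (N : Set V) (P R : V) : Prop :=
  R ∈ N ∧ ∀ S ∈ N, X.edgeDist P S = X.edgeDist P R + X.edgeDist R S

/-- A set of vertices that contains all vertices between two of its members. -/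
def IsConvex (X : CubeComplex V) (N : Set V) : Prop :=
  ∀ u ∈ N, ∀ v ∈ N, ∀ x, X.edgeDist u x + X.edgeDist x v = X.edgeDist u v → x ∈ N

/-- The edges of the subgraph induced on `N`. -/
def InducedAdj (X : CubeComplex V) (N : Set V) (u v : V) : Prop :=
  u ∈ N ∧ v ∈ N ∧ X.oneSkeleton.Adj u v

namespace IsCAT0

/-- From a nearest point of `N` no descent within `N` is possible, so by confluence every other
point of `N` descends to it. -/
lemma exists_isGate (hX : X.IsCAT0) {N : Set V} (hne : N.Nonempty)
    (hconn : ∀ u ∈ N, ∀ v ∈ N, Relation.ReflTransGen (X.InducedAdj N) u v)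
    (hsq : ∀ z u x w, z ∈ N → u ∈ N → w ∈ N → X.Sq z u x w → x ∈ N) (P : V) :
    ∃ R, X.IsGate N P R := by
  obtain ⟨R, hR, hmin⟩ := (measure (X.edgeDist P)).wf.has_min N hne
  refine ⟨R, hR, fun S hS => ?_⟩
  have hadj : ∀ s t, X.InducedAdj N s t → X.oneSkeleton.Adj (id s) (id t) := fun _ _ h => h.2.2
  obtain ⟨T, hRT, hST⟩ := hX.join_descends (P := P) (f := id) (r := X.InducedAdj N)
    (fun _ _ h => ⟨h.2.1, h.1, h.2.2.symm⟩) hadj (fun _ _ _ _ _ h => h)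
    (fun s t t' x h h' hx => by
      have hxN := hsq _ _ _ _ h.1 h.2.1 h'.2.1 hx
      exact ⟨x, rfl, ⟨h.2.1, hxN, hx.bc⟩, ⟨h'.2.1, hxN, hx.cd.symm⟩⟩) (hconn R hR S hS)
  have hT : T ∈ N := by
    cases hRT with
    | refl => exact hR
    | tail _ h => exact h.1.2.1
  obtain rfl : R = T := eq_of_descends_of_le hRT (not_lt.1 (hmin T hT))
  exact hX.edgeDist_of_descends hadj hST

lemma isConvex_of_isGate (hX : X.IsCAT0) {N : Set V} (h : ∀ P, ∃ R, X.IsGate N P R) :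
    X.IsConvex N := by
  intro u hu v hv x hx
  obtain ⟨R, hR, hg⟩ := h x
  have h₁ := hg u hu
  have h₂ := hg v hv
  have h₃ := hX.edgeDist_triangle u R v
  rw [edgeDist_comm x u, edgeDist_comm R u] at h₁
  have : x = R := hX.eq_of_edgeDist (by omega)
  exact this ▸ hR

lemma reflTransGen_of_isConvex (hX : X.IsCAT0) {N : Set V} (h : X.IsConvex N) {u v : V}
    (hu : u ∈ N) (hv : v ∈ N) : Relation.ReflTransGen (X.InducedAdj N) u v := by
  induction hn : X.edgeDist u v generalizing v with
  | zero => rw [hX.eq_of_edgeDist hn]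
  | succ n ih =>
    obtain ⟨w, hw, hd⟩ := hX.exists_adj_edgeDist hn
    have hwN := h u hu v hv w (by rw [hd, edgeDist_of_adj hw, hn])
    exact (ih hwN hd).tail ⟨hwN, hv, hw⟩

lemma edgeDist_sq (hX : X.IsCAT0) {a b c d : V} (h : X.Sq a b c d) : X.edgeDist a c = 2 := by
  have h₁ := hX.edgeDist_adj a h.bc
  rw [edgeDist_of_adj h.ab] at h₁
  have h₂ : X.edgeDist a c ≠ 0 := fun h' => h.ne (hX.eq_of_edgeDist h')
  omega

/-- Convex sets are gated. -/
theorem exists_isGate_of_isConvex (hX : X.IsCAT0) {N : Set V} (h : X.IsConvex N)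
    (hne : N.Nonempty) (P : V) : ∃ R, X.IsGate N P R :=
  hX.exists_isGate hne (fun _ hu _ hv => hX.reflTransGen_of_isConvex h hu hv)
    (fun z u x w _ hu hw hsq => h u hu w hw x (by
      rw [edgeDist_of_adj hsq.bc, edgeDist_of_adj hsq.cd, hX.edgeDist_sq hsq.rotate])) P

end IsCAT0

/-! ### Parallel edges -/

/-- The oriented edges `e` and `e'` are opposite edges of a square. -/
def Opposite (X : CubeComplex V) (e e' : V × V) : Prop := X.Sq e.1 e.2 e'.2 e'.1

/-- The oriented edges `e` and `e'` are joined by a finite sequence of squares, in which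
consecutive squares meet in opposite edges. -/
def ParallelEdges (X : CubeComplex V) : V × V → V × V → Prop :=
  Relation.ReflTransGen X.Opposite

lemma Opposite.symm {e e' : V × V} (h : X.Opposite e e') : X.Opposite e' e :=
  (Sq.rotateRight h).reflect

namespace ParallelEdges

lemma symm {e e' : V × V} (h : X.ParallelEdges e e') : X.ParallelEdges e' e := by
  induction h with
  | refl => exact .refl
  | tail _ h ih => exact (Relation.ReflTransGen.single h.symm).trans ih

lemma swap {a b c d : V} (h : X.ParallelEdges (a, b) (c, d)) : X.ParallelEdges (b, a) (d, c) :=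
  Relation.ReflTransGen.lift Prod.swap
    (fun _ _ h => (Sq.rotate h).reflect) _ _ h

/-- Confluence is applied to oriented edges, seen through their first endpoints; filling a corner to
a cube closes the diamonds. The base point is the first endpoint of `e'`, so `e'` itself cannot
descend. -/
lemma descends (hX : X.IsCAT0) {e e' : V × V} (h : X.ParallelEdges e e') :
    Relation.ReflTransGen (X.Descends e'.1 Prod.fst X.Opposite) e e' := by
  obtain ⟨d, hd, hd'⟩ := hX.join_descends (P := e'.1) (f := Prod.fst) (r := X.Opposite)
    (fun _ _ h => h.symm) (fun _ _ h => (Sq.da h).symm)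
    (fun s t t' h h' hf => by
      refine Prod.ext hf ?_
      unfold Opposite at h h'
      rw [hf] at h
      exact h.unique h')
    (fun s t t' x h h' hx => by
      obtain ⟨r, h₁, h₂, h₃⟩ := hX.2.exists_cube h h' hx
      exact ⟨(x, r), rfl, h₂, h₃⟩) h
  obtain rfl : e' = d := eq_of_descends_of_le hd' (by simp [edgeDist_self])
  exact hd

lemma eq_snd (hX : X.IsCAT0) {a b d : V} (h : X.ParallelEdges (a, b) (a, d)) : b = d := by
  have := eq_of_descends_of_le (h.descends hX) le_rfl
  exact (Prod.ext_iff.1 this).2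

lemma sq (hX : X.IsCAT0) {a b c d : V} (h : X.ParallelEdges (a, b) (c, d))
    (hac : X.oneSkeleton.Adj a c) : X.Sq a b d c := by
  have h' := h.descends hX
  rcases h'.cases_head with he | ⟨e, he, h'⟩
  · exact absurd (Prod.ext_iff.1 he).1 hac.ne
  · have h₁ := he.2
    have : X.edgeDist c e.1 = 0 := by
      have : X.edgeDist c a = X.edgeDist c e.1 + 1 := h₁
      rw [edgeDist_of_adj hac.symm] at this
      omega
    obtain rfl := eq_of_descends_of_le h' (by simp [this])
    exact he.1

/-- This rules out reversed orientations below. If the second endpoint of an edge in the descending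
chain were the closer one, the quadrangle condition would put the second endpoint of the next edge
too close to `a`. -/
lemma edgeDist_snd (hX : X.IsCAT0) {a b c d : V} (h : X.ParallelEdges (a, b) (c, d))
    (hab : X.oneSkeleton.Adj a b) : X.edgeDist a d = X.edgeDist a c + 1 := by
  suffices ∀ e, Relation.ReflTransGen (X.Descends a Prod.fst X.Opposite) e (a, b) →
      X.edgeDist a e.2 = X.edgeDist a e.1 + 1 from this _ (h.symm.descends hX)
  intro e he
  induction he using Relation.ReflTransGen.head_induction_on with
  | refl => simp [edgeDist_self, edgeDist_of_adj hab]
  | @head e e' hee _ ih =>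
    obtain ⟨hsq, hd⟩ := hee
    unfold Opposite at hsq
    rcases hX.edgeDist_adj a hsq.ab with h | h
    · obtain ⟨x, hx, hxd⟩ := hX.quadrangle hsq.ab.symm hsq.da h hd hsq.ne'
      obtain rfl := hx.unique hsq
      omega
    · exact h

end ParallelEdges

/-! ### Hyperplanes as parallelism classes of edges -/

/-- Two edges are parallel when one of them is suitably oriented. -/
def ParallelUpToSwap (X : CubeComplex V) (e e' : V × V) : Prop :=
  X.ParallelEdges e e' ∨ X.ParallelEdges e e'.swap

namespace ParallelUpToSwap

lemma of_mk_eq {a b c d : V} (h : s(a, b) = s(c, d)) :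
    X.ParallelUpToSwap (a, b) (c, d) := by
  rcases Sym2.eq_iff.1 h with ⟨rfl, rfl⟩ | ⟨rfl, rfl⟩
  · exact Or.inl .refl
  · exact Or.inr .refl

lemma symm {e e' : V × V} (h : X.ParallelUpToSwap e e') : X.ParallelUpToSwap e' e := by
  rcases h with h | h
  · exact Or.inl h.symm
  · exact Or.inr h.symm.swap

lemma trans {e e' e'' : V × V} (h : X.ParallelUpToSwap e e') (h' : X.ParallelUpToSwap e' e'') :
    X.ParallelUpToSwap e e'' := by
  rcases h with h | h <;> rcases h' with h' | h'
  · exact Or.inl (Relation.ReflTransGen.trans h h')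
  · exact Or.inr (Relation.ReflTransGen.trans h h')
  · exact Or.inr (Relation.ReflTransGen.trans h h'.swap)
  · exact Or.inl (Relation.ReflTransGen.trans h h'.swap)

end ParallelUpToSwap

lemma _root_.IsCubeChart.parallelEdges {C : Set V} {q : ℕ} {φ : (Fin q → Bool) → V}
    (h : IsCubeChart X.cubes C φ) {i : Fin q} {x y : Fin q → Bool} (hxy : x i = y i) :
    X.ParallelEdges (φ x, φ (flipAt x i)) (φ y, φ (flipAt y i)) := by
  -- `T` is the set of coordinates already changed from `x` to `y`; each actual change crosses one
  -- square.
  suffices ∀ T : Finset (Fin q), X.ParallelEdges (φ x, φ (flipAt x i))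
      (φ fun j => if j ∈ T then y j else x j,
        φ (flipAt (fun j => if j ∈ T then y j else x j) i)) by
    simpa using this Finset.univ
  intro T
  induction T using Finset.induction_on with
  | empty =>
    simp only [Finset.notMem_empty, if_false]
    exact .refl
  | insert j T hj ih =>
    set z : Fin q → Bool := fun k => if k ∈ T then y k else x k with hz
    by_cases hxyj : x j = y j
    · have : (fun k => if k ∈ insert j T then y k else x k) = z := by
        funext k
        by_cases hk : k = j
        · subst hk; simp [hz, hj, hxyj]
        · simp [hz, hk]
      rwa [this]
    · have : (fun k => if k ∈ insert j T then y k else x k) = flipAt z j := by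
        funext k
        by_cases hk : k = j
        · subst hk
          simp only [Finset.mem_insert_self, if_true, flipAt_same, hz, hj, if_false]
          revert hxyj; cases x k <;> cases y k <;> simp
        · simp [hz, hk, flipAt_of_ne]
      rw [this]
      have hij : i ≠ j := by rintro rfl; exact hxyj hxy
      refine Relation.ReflTransGen.tail ih ?_
      have := h.sq z hij
      rwa [flipAt_comm] at this

lemma _root_.IsCubeChart.parallelUpToSwap {C : Set V} {q : ℕ} {φ : (Fin q → Bool) → V}
    (h : IsCubeChart X.cubes C φ) (i : Fin q) (x y : Fin q → Bool) :
    X.ParallelUpToSwap (φ x, φ (flipAt x i)) (φ y, φ (flipAt y i)) := by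
  by_cases hxy : x i = y i
  · exact Or.inl (h.parallelEdges hxy)
  · have := h.parallelEdges (i := i) (x := x) (y := flipAt y i) (by
      rw [flipAt_same]; revert hxy; cases x i <;> cases y i <;> simp)
    rw [flipAt_flipAt] at this
    exact Or.inr this

lemma IsMidplane.adj {M : Set (Sym2 V)} (hM : X.IsMidplane M) {a b : V} (h : s(a, b) ∈ M) :
    X.oneSkeleton.Adj a b := by
  obtain ⟨C, -, q, φ, i, hφ, rfl⟩ := hM
  obtain ⟨x, hx⟩ := h
  have := hφ.adj_flipAt x i
  rcases Sym2.eq_iff.1 hx with ⟨rfl, rfl⟩ | ⟨rfl, rfl⟩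
  · exact this
  · exact this.symm

lemma IsMidplane.parallelUpToSwap {M : Set (Sym2 V)} (hM : X.IsMidplane M) {a b c d : V}
    (h : s(a, b) ∈ M) (h' : s(c, d) ∈ M) : X.ParallelUpToSwap (a, b) (c, d) := by
  obtain ⟨C, -, q, φ, i, hφ, rfl⟩ := hM
  obtain ⟨x, hx⟩ := h
  obtain ⟨y, hy⟩ := h'
  exact ((ParallelUpToSwap.of_mk_eq hx).symm.trans (hφ.parallelUpToSwap i x y)).trans
    (.of_mk_eq hy)

lemma IsMidplane.nonempty {M : Set (Sym2 V)} (hM : X.IsMidplane M) : ∃ a b, s(a, b) ∈ M := by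
  obtain ⟨C, -, q, φ, i, hφ, rfl⟩ := hM
  exact ⟨_, _, fun _ => false, rfl⟩

lemma isMidplane_singleton {a b : V} (h : X.oneSkeleton.Adj a b) : X.IsMidplane {s(a, b)} := by
  obtain ⟨hC, φ, hφ⟩ := h.2
  refine ⟨_, hC, 1, φ, 0, hφ, ?_⟩
  have key : ∀ x : Fin 1 → Bool, s(φ x, φ (flipAt x 0)) = s(a, b) := by
    intro x
    have h₁ := hφ.mem x
    have h₂ := hφ.mem (flipAt x 0)
    have h₃ := (hφ.adj_flipAt x 0).ne
    rw [Sym2.eq_iff]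
    simp only [Set.mem_insert_iff, Set.mem_singleton_iff] at h₁ h₂
    rcases h₁ with h₁ | h₁ <;> rcases h₂ with h₂ | h₂
    · exact absurd (h₁.trans h₂.symm) h₃
    · exact Or.inl ⟨h₁, h₂⟩
    · exact Or.inr ⟨h₁, h₂⟩
    · exact absurd (h₁.trans h₂.symm) h₃
  ext e
  constructor
  · rintro rfl
    exact ⟨fun _ => false, key _⟩
  · rintro ⟨x, rfl⟩
    exact key x

lemma Sq.exists_midplane {a b c d : V} (h : X.Sq a b c d) :
    ∃ M, X.IsMidplane M ∧ s(a, b) ∈ M ∧ s(d, c) ∈ M := by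
  obtain ⟨hC, φ, hφ⟩ := h.cube
  obtain ⟨x, rfl⟩ := hφ.exists_eq (v := a) (by simp)
  obtain ⟨i, rfl⟩ := hφ.eq_flipAt_of_adj (v := b) (by simp) h.ab
  obtain ⟨j, rfl⟩ := hφ.eq_flipAt_of_adj (v := d) (by simp) h.da.symm
  have hij : i ≠ j := fun e => h.ne' (by rw [e])
  obtain rfl := h.unique (hφ.sq x hij)
  refine ⟨_, ⟨_, hC, 2, φ, i, hφ, rfl⟩, ⟨x, rfl⟩, flipAt x j, ?_⟩
  rw [flipAt_comm x i j]; rfl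

lemma MidplaneEquiv.isMidplane {M N : Set (Sym2 V)} (h : X.MidplaneEquiv M N)
    (hM : X.IsMidplane M) : X.IsMidplane N := by
  cases h with
  | refl => exact hM
  | tail _ h => exact h.2.1

lemma MidplaneEquiv.parallelUpToSwap {M N : Set (Sym2 V)} (h : X.MidplaneEquiv M N)
    (hM : X.IsMidplane M) {a b c d : V} (hab : s(a, b) ∈ M) (hcd : s(c, d) ∈ N) :
    X.ParallelUpToSwap (a, b) (c, d) := by
  induction h generalizing c d with
  | refl => exact hM.parallelUpToSwap hab hcd
  | tail _ h ih =>
    obtain ⟨p, r, hp⟩ := h.2.2.nonempty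
    exact (ih hp.1).trans (h.2.1.parallelUpToSwap hp.2 hcd)

/-- Midplanes that cross a common edge are equivalent. -/
lemma midplaneEquiv_of_mem {M N : Set (Sym2 V)} (hM : X.IsMidplane M) (hN : X.IsMidplane N)
    {a b : V} (h : s(a, b) ∈ M) (h' : s(a, b) ∈ N) : X.MidplaneEquiv M N := by
  have hs := isMidplane_singleton (hM.adj h)
  -- The common edge, as a midplane of itself, is the intermediate term.
  refine (Relation.ReflTransGen.single (b := {s(a, b)}) ⟨hM, hs, ?_⟩).tail ⟨hs, hN, ?_⟩
  · rwa [Set.inter_eq_self_of_subset_left (Set.singleton_subset_iff.2 h')]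
  · rwa [Set.inter_eq_self_of_subset_right (Set.singleton_subset_iff.2 h)]

lemma exists_isHyperplane {a b : V} (h : X.oneSkeleton.Adj a b) :
    ∃ H, X.IsHyperplane H ∧ s(a, b) ∈ H :=
  ⟨_, ⟨{s(a, b)}, isMidplane_singleton h, rfl⟩, {s(a, b)}, .refl, rfl⟩

namespace IsHyperplane

variable {H K : Set (Sym2 V)}

lemma adj (hH : X.IsHyperplane H) {a b : V} (h : s(a, b) ∈ H) : X.oneSkeleton.Adj a b := by
  obtain ⟨M, hM, rfl⟩ := hH
  obtain ⟨N, hN, h⟩ := h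
  exact (MidplaneEquiv.isMidplane hN hM).adj h

lemma subset_of_midplane (hH : X.IsHyperplane H) {M : Set (Sym2 V)} (hM : X.IsMidplane M)
    {a b : V} (h : s(a, b) ∈ H) (h' : s(a, b) ∈ M) : M ⊆ H := by
  obtain ⟨M', hM', rfl⟩ := hH
  obtain ⟨N, hN, h⟩ := h
  intro e he
  exact ⟨M, Relation.ReflTransGen.trans hN
    (midplaneEquiv_of_mem (MidplaneEquiv.isMidplane hN hM') hM h h'), he⟩

lemma subset_of_mem (hH : X.IsHyperplane H) (hK : X.IsHyperplane K) {a b : V}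
    (h : s(a, b) ∈ H) (h' : s(a, b) ∈ K) : K ⊆ H := by
  obtain ⟨M, hM, rfl⟩ := hH
  obtain ⟨M', hM', rfl⟩ := hK
  obtain ⟨N, hN, h⟩ := h
  obtain ⟨N', hN', h'⟩ := h'
  rintro e ⟨L, hL, he⟩
  have hN₁ := MidplaneEquiv.isMidplane hN hM
  have hN₁' := MidplaneEquiv.isMidplane hN' hM'
  have hback : X.MidplaneEquiv N' M' := by
    have : Std.Symm (fun A B => X.IsMidplane A ∧ X.IsMidplane B ∧ X.IsMidplane (A ∩ B)) :=
      ⟨fun A B h => ⟨h.2.1, h.1, by rw [Set.inter_comm]; exact h.2.2⟩⟩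
    exact Std.Symm.symm (r := Relation.ReflTransGen _) _ _ hN'
  exact ⟨L, ((Relation.ReflTransGen.trans hN (midplaneEquiv_of_mem hN₁ hN₁' h h')).trans
    hback).trans hL, he⟩

/-- A hyperplane is determined by each of its edges. -/
lemma eq_of_mem (hH : X.IsHyperplane H) (hK : X.IsHyperplane K) {a b : V}
    (h : s(a, b) ∈ H) (h' : s(a, b) ∈ K) : H = K :=
  (hK.subset_of_mem hH h' h).antisymm (hH.subset_of_mem hK h h')

lemma parallelUpToSwap (hH : X.IsHyperplane H) {a b c d : V} (h : s(a, b) ∈ H)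
    (h' : s(c, d) ∈ H) : X.ParallelUpToSwap (a, b) (c, d) := by
  obtain ⟨M, hM, rfl⟩ := hH
  obtain ⟨N, hN, h⟩ := h
  obtain ⟨N', hN', h'⟩ := h'
  obtain ⟨p, r, hp⟩ := hM.nonempty
  exact (MidplaneEquiv.parallelUpToSwap hN hM hp h).symm.trans
    (MidplaneEquiv.parallelUpToSwap hN' hM hp h')

lemma mem_of_sq (hH : X.IsHyperplane H) {a b c d : V} (h : s(a, b) ∈ H) (hsq : X.Sq a b c d) :
    s(d, c) ∈ H := by
  obtain ⟨M, hM, h₁, h₂⟩ := hsq.exists_midplane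
  exact hH.subset_of_midplane hM h h₁ h₂

/-- Equally oriented parallel edges at `a` coincide; opposite orientations would give d(a,a) =
d(a,c) + 1. -/
lemma unique (hX : X.IsCAT0) (hH : X.IsHyperplane H) {a b c : V} (h : s(a, b) ∈ H)
    (h' : s(a, c) ∈ H) : b = c := by
  rcases hH.parallelUpToSwap h h' with hp | hp
  · exact hp.eq_snd hX
  · have := hp.edgeDist_snd hX (hH.adj h)
    rw [edgeDist_self] at this
    omega

/-- The condition `b ≠ c` excludes that the edge from `a` to `c` itself crosses `H`, which is what
the reversed orientation would mean. -/
lemma sq_of_adj (hX : X.IsCAT0) (hH : X.IsHyperplane H) {a b c d : V} (h : s(a, b) ∈ H)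
    (h' : s(c, d) ∈ H) (hac : X.oneSkeleton.Adj a c) (hbc : b ≠ c) : X.Sq a b d c := by
  rcases hH.parallelUpToSwap h h' with hp | hp
  · exact hp.sq hX hac
  · have h₁ : X.edgeDist a c = X.edgeDist a d + 1 := hp.edgeDist_snd hX (hH.adj h)
    rw [edgeDist_of_adj hac] at h₁
    obtain rfl : a = d := hX.eq_of_edgeDist (by omega)
    rw [Sym2.eq_swap] at h'
    exact absurd (hH.unique hX h h') hbc

end IsHyperplane

/-! ### Carriers of hyperplanes -/

/-- The endpoints of the edges that cross `H`. -/
def carrier (H : Set (Sym2 V)) : Set V := {v | ∃ w, s(v, w) ∈ H}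

namespace IsHyperplane

variable {H K : Set (Sym2 V)}

lemma reflTransGen_carrier (hH : X.IsHyperplane H) {u v : V} (hu : u ∈ carrier H)
    (hv : v ∈ carrier H) : Relation.ReflTransGen (X.InducedAdj (carrier H)) u v := by
  obtain ⟨u', hu⟩ := hu
  obtain ⟨v', hv⟩ := hv
  have key : ∀ e, X.ParallelEdges (u, u') e → s(e.1, e.2) ∈ H ∧
      Relation.ReflTransGen (X.InducedAdj (carrier H)) u e.1 := by
    intro e he
    induction he with
    | refl => exact ⟨hu, .refl⟩
    | tail _ h ih =>
      have h' := hH.mem_of_sq ih.1 h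
      exact ⟨h', ih.2.tail ⟨⟨_, ih.1⟩, ⟨_, h'⟩, (Sq.da h).symm⟩⟩
  rcases hH.parallelUpToSwap hu hv with h | h
  · exact (key _ h).2
  · have h₁ := key _ h
    exact h₁.2.tail ⟨⟨_, h₁.1⟩, ⟨_, hv⟩, hH.adj h₁.1⟩

/-- Either a side of the square at `z` crosses `H`, and then so does the opposite side, or the edge
crossing `H` at `z` spans a 3-cube with the square. -/
lemma sq_mem_carrier (hX : X.IsCAT0) (hH : X.IsHyperplane H) {z u x w : V}
    (hz : z ∈ carrier H) (hu : u ∈ carrier H) (hw : w ∈ carrier H) (hsq : X.Sq z u x w) :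
    x ∈ carrier H := by
  obtain ⟨z', hz⟩ := hz
  obtain ⟨u', hu⟩ := hu
  obtain ⟨w', hw⟩ := hw
  by_cases hzu : z' = u
  · subst hzu
    refine ⟨w, ?_⟩
    rw [Sym2.eq_swap]
    exact hH.mem_of_sq hz hsq
  by_cases hzw : z' = w
  · subst hzw
    refine ⟨u, ?_⟩
    rw [Sym2.eq_swap]
    exact hH.mem_of_sq hz hsq.reflect
  obtain ⟨r, -, h, -⟩ := hX.2.exists_cube (hH.sq_of_adj hX hz hu hsq.ab hzu)
    (hH.sq_of_adj hX hz hw hsq.da.symm hzw) hsq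
  exact ⟨r, hH.mem_of_sq hu h⟩

lemma isConvex_carrier (hX : X.IsCAT0) (hH : X.IsHyperplane H) : X.IsConvex (carrier H) := by
  have hne : (carrier H).Nonempty := by
    obtain ⟨M, hM, rfl⟩ := hH
    obtain ⟨a, b, h⟩ := hM.nonempty
    exact ⟨a, b, M, .refl, h⟩
  exact hX.isConvex_of_isGate (hX.exists_isGate hne
    (fun _ hu _ hv => hH.reflTransGen_carrier hu hv)
    (fun _ _ _ _ hz hu hw hsq => hH.sq_mem_carrier hX hz hu hw hsq))

/-- If two hyperplanes cross, then they cross at every vertex in both of their carriers. -/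
lemma exists_sq (hX : X.IsCAT0) (hH : X.IsHyperplane H) (hK : X.IsHyperplane K)
    {a b c d : V} (hsq : X.Sq a b c d) (hab : s(a, b) ∈ H) (had : s(a, d) ∈ K)
    {v b' d' : V} (hb' : s(v, b') ∈ H) (hd' : s(v, d') ∈ K) : ∃ c', X.Sq v b' c' d' := by
  have hconv : X.IsConvex (carrier H ∩ carrier K) := fun u hu v hv x hx =>
    ⟨hH.isConvex_carrier hX u hu.1 v hv.1 x hx, hK.isConvex_carrier hX u hu.2 v hv.2 x hx⟩
  -- The intersection of the carriers is convex, hence connected, so the square can be moved along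
  -- its edges. A step across `H` or `K` stays in the same square; any other step moves to the
  -- opposite face of a 3-cube.
  have hconn := hX.reflTransGen_of_isConvex hconv (u := a) (v := v) ⟨⟨b, hab⟩, ⟨d, had⟩⟩
    ⟨⟨b', hb'⟩, ⟨d', hd'⟩⟩
  induction hconn generalizing b' d' with
  | refl =>
    obtain rfl := hH.unique hX hab hb'
    obtain rfl := hK.unique hX had hd'
    exact ⟨c, hsq⟩
  | @tail u w _ huw ih =>
    obtain ⟨⟨⟨p, hp⟩, ⟨r, hr⟩⟩, -, hadj⟩ := huw
    obtain ⟨t, ht⟩ := ih hp hr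
    by_cases hpw : p = w
    · subst hpw
      have h₁ : s(p, u) ∈ H := by rwa [Sym2.eq_swap]
      obtain rfl := hH.unique hX h₁ hb'
      obtain rfl := hK.unique hX (hK.mem_of_sq hr ht.reflect) hd'
      exact ⟨r, ht.rotate.reflect⟩
    by_cases hrw : r = w
    · subst hrw
      have h₁ : s(r, u) ∈ K := by rwa [Sym2.eq_swap]
      obtain rfl := hK.unique hX h₁ hd'
      obtain rfl := hH.unique hX (hH.mem_of_sq hp ht) hb'
      exact ⟨p, ht.rotateRight.reflect⟩
    obtain ⟨y, -, -, h⟩ := hX.2.exists_cube ht (hH.sq_of_adj hX hp hb' hadj hpw)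
      (hK.sq_of_adj hX hr hd' hadj hrw)
    exact ⟨y, h⟩

end IsHyperplane

/-! ### Parallelism classes of cubes -/

lemma IsHyperplane.cuts_of_mem {H : Set (Sym2 V)} (hH : X.IsHyperplane H) {C : Set V}
    {a b : V} (hC : C ∈ X.cubes) (ha : a ∈ C) (hb : b ∈ C) (h : s(a, b) ∈ H) : X.Cuts H C := by
  obtain ⟨q, φ, hφ⟩ := X.exists_chart C hC
  obtain ⟨x, rfl⟩ := hφ.exists_eq ha
  obtain ⟨i, rfl⟩ := hφ.eq_flipAt_of_adj hb (hH.adj h)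
  have hM : X.IsMidplaneOf C (Set.range fun x => s(φ x, φ (Function.update x i (!(x i))))) :=
    ⟨q, φ, i, hφ, rfl⟩
  exact ⟨_, hM, hH.subset_of_midplane ⟨C, hC, hM⟩ h ⟨x, rfl⟩⟩

/-- A hyperplane that cuts a cube crosses an edge of this cube at each vertex of the cube. -/
lemma Cuts.exists_mem {H : Set (Sym2 V)} {C : Set V} (h : X.Cuts H C) {v : V} (hv : v ∈ C) :
    ∃ w ∈ C, s(v, w) ∈ H := by
  obtain ⟨M, ⟨q, φ, i, hφ, rfl⟩, hM⟩ := h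
  obtain ⟨x, rfl⟩ := hφ.exists_eq hv
  exact ⟨φ (flipAt x i), hφ.mem _, hM ⟨x, rfl⟩⟩

/-- The hyperplanes `H i` are those crossed by the edges of the `q`-cube `C` at one of its
vertices. -/
structure IsCornerSystem (X : CubeComplex V) {q : ℕ} (C : Set V) (H : Fin q → Set (Sym2 V)) :
    Prop where
  isCube : X.IsCube q C
  isHyperplane : ∀ i, X.IsHyperplane (H i)
  injective : Function.Injective H
  cuts : ∀ i, X.Cuts (H i) C
  eq_of_cuts : ∀ K, X.IsHyperplane K → X.Cuts K C → ∃ i, K = H i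

lemma IsCAT0.exists_isCornerSystem (hX : X.IsCAT0) {q : ℕ} {C : Set V} (hC : X.IsCube q C) :
    ∃ H : Fin q → Set (Sym2 V), X.IsCornerSystem C H := by
  obtain ⟨φ, hφ⟩ := hC.2
  set x : Fin q → Bool := fun _ => false
  choose H hH hmem using fun i => exists_isHyperplane (hφ.adj_flipAt x i)
  refine ⟨H, hC, hH, fun i j hij => ?_, fun i => ?_, fun K hK hcut => ?_⟩
  · have h := hmem j
    rw [← hij] at h
    exact flipAt_injective x (hφ.1 ((hH i).unique hX (hmem i) h))
  · exact (hH i).cuts_of_mem hC.1 (hφ.mem _) (hφ.mem _) (hmem i)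
  · obtain ⟨w, hw, hK'⟩ := hcut.exists_mem (hφ.mem x)
    obtain ⟨i, rfl⟩ := hφ.eq_flipAt_of_adj hw (hK.adj hK')
    exact ⟨i, hK.eq_of_mem (hH i) hK' (hmem i)⟩

namespace IsCornerSystem

variable {q : ℕ} {C : Set V} {H : Fin q → Set (Sym2 V)}

lemma isCube_of_parallel (h : X.IsCornerSystem C H) {D : Set V} (hD : X.Parallel C D) :
    X.IsCube q D := by
  obtain ⟨⟨q', ⟨-, φ', hφ'⟩, hD⟩, -⟩ := hD
  obtain ⟨-, φ, hφ⟩ := h.isCube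
  have := hφ.ncard.symm.trans hφ'.ncard
  rwa [Nat.pow_right_injective le_rfl this]

lemma exists_sq (hX : X.IsCAT0) (h : X.IsCornerSystem C H) {i j : Fin q} (hij : i ≠ j)
    {v a b : V} (ha : s(v, a) ∈ H i) (hb : s(v, b) ∈ H j) : ∃ c, X.Sq v a c b := by
  obtain ⟨φ, hφ⟩ := h.isCube.2
  have hv := hφ.mem fun _ => false
  obtain ⟨a', ha', hi⟩ := (h.cuts i).exists_mem hv
  obtain ⟨b', hb', hj⟩ := (h.cuts j).exists_mem hv
  have hab : a' ≠ b' := by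
    rintro rfl
    exact hij (h.injective ((h.isHyperplane i).eq_of_mem (h.isHyperplane j) hi hj))
  obtain ⟨c', hsq⟩ := exists_sq_of_isCube h.isCube hv ha' hb' ((h.isHyperplane i).adj hi)
    ((h.isHyperplane j).adj hj) hab
  exact (h.isHyperplane i).exists_sq hX (h.isHyperplane j) hsq hi hj ha hb

/-- A vertex in the carriers of all the hyperplanes that cut `C` is a vertex of a cube that is
parallel to `C`. -/
lemma exists_parallel (hX : X.IsCAT0) (h : X.IsCornerSystem C H) {v : V}
    (hv : ∀ i, v ∈ carrier (H i)) : ∃ D, X.Parallel C D ∧ v ∈ D := by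
  classical
  choose a ha using hv
  have hinj : Function.Injective a := fun i j hij => by
    have h₁ := ha j
    rw [← hij] at h₁
    exact h.injective ((h.isHyperplane i).eq_of_mem (h.isHyperplane j) (ha i) h₁)
  -- The `H i` cross pairwise in `C`, hence also at `v`, so the flag condition yields a cube; it has
  -- dimension `q` because the edges are distinct.
  obtain ⟨D, hD, hvD, hS⟩ := hX.2 v (Finset.univ.image a)
    (by
      simp only [Finset.mem_image, Finset.mem_univ, true_and]
      rintro _ ⟨i, rfl⟩
      exact (h.isHyperplane i).adj (ha i))
    (by
      simp only [Finset.mem_image, Finset.mem_univ, true_and]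
      rintro _ ⟨i, rfl⟩ _ ⟨j, rfl⟩ hij
      obtain ⟨c, hc⟩ := h.exists_sq hX (by rintro rfl; exact hij rfl) (ha i) (ha j)
      exact ⟨_, hc.cube, by simp, by simp, by simp⟩)
  rw [Finset.card_image_of_injective _ hinj, Finset.card_univ, Fintype.card_fin] at hD
  refine ⟨D, ⟨⟨q, h.isCube, hD⟩, fun K hK hcut => ?_⟩, hvD⟩
  obtain ⟨i, rfl⟩ := h.eq_of_cuts K hK hcut
  exact hK.cuts_of_mem hD.1 hvD (hS (by simp)) (ha i)

lemma sUnion_parallel_eq (hX : X.IsCAT0) (h : X.IsCornerSystem C H) :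
    ⋃₀ {D | X.Parallel C D} = ⋂ i, carrier (H i) := by
  ext v
  rw [Set.mem_iInter]
  constructor
  · rintro ⟨D, hD, hv⟩ i
    obtain ⟨w, -, hw⟩ := (hD.2 _ (h.isHyperplane i) (h.cuts i)).exists_mem hv
    exact ⟨w, hw⟩
  · intro hv
    obtain ⟨D, hD, hvD⟩ := h.exists_parallel hX hv
    exact ⟨D, hD, hvD⟩

/-- Each `H i` crosses only one edge at `v`, which therefore lies in both cubes, and these edges
form the whole corner of `D` at `v`. -/
lemma subset_of_parallel (hX : X.IsCAT0) (h : X.IsCornerSystem C H) {D D' : Set V}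
    (hD : X.Parallel C D) (hD' : X.Parallel C D') {v : V} (hv : v ∈ D) (hv' : v ∈ D') :
    D ⊆ D' := by
  obtain ⟨-, φ, hφ⟩ := h.isCube_of_parallel hD
  obtain ⟨x, rfl⟩ := hφ.exists_eq hv
  have key : ∀ i, ∃ k, s(φ x, φ (flipAt x k)) ∈ H i := fun i => by
    obtain ⟨w, hw, hi⟩ := (hD.2 _ (h.isHyperplane i) (h.cuts i)).exists_mem hv
    obtain ⟨k, rfl⟩ := hφ.eq_flipAt_of_adj hw ((h.isHyperplane i).adj hi)
    exact ⟨k, hi⟩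
  choose σ hσ using key
  have hinj : Function.Injective σ := fun i j hij => by
    have h₁ := hσ j
    rw [← hij] at h₁
    exact h.injective ((h.isHyperplane i).eq_of_mem (h.isHyperplane j) (hσ i) h₁)
  refine hφ.subset_of_corner (h.isCube_of_parallel hD').1 x hv' fun k => ?_
  -- Distinct hyperplanes use distinct directions, and there are `q` of each.
  obtain ⟨i, rfl⟩ := Finite.surjective_of_injective hinj k
  obtain ⟨w, hw, hi⟩ := (hD'.2 _ (h.isHyperplane i) (h.cuts i)).exists_mem hv'
  rwa [(h.isHyperplane i).unique hX (hσ i) hi]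

end IsCornerSystem

/-- A vertex lies in at most one cube of a parallelism class. -/
lemma IsCAT0.eq_of_parallel (hX : X.IsCAT0) {q : ℕ} {C D D' : Set V} (hC : X.IsCube q C)
    (hD : X.Parallel C D) (hD' : X.Parallel C D') {v : V} (hv : v ∈ D) (hv' : v ∈ D') :
    D = D' := by
  obtain ⟨H, h⟩ := hX.exists_isCornerSystem hC
  exact (h.subset_of_parallel hX hD hD' hv hv').antisymm (h.subset_of_parallel hX hD' hD hv' hv)

/-- The vertices of the cubes in a parallelism class form a convex set. -/
lemma IsCAT0.isConvex_sUnion_parallel (hX : X.IsCAT0) {q : ℕ} {C : Set V} (hC : X.IsCube q C) :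
    X.IsConvex (⋃₀ {D | X.Parallel C D}) := by
  obtain ⟨H, h⟩ := hX.exists_isCornerSystem hC
  rw [h.sUnion_parallel_eq hX]
  intro u hu v hv x hx
  rw [Set.mem_iInter] at *
  exact fun i => (h.isHyperplane i).isConvex_carrier hX u (hu i) v (hv i) x hx

lemma distToCube_le (P : V) {C : Set V} {v : V} (hv : v ∈ C) :
    X.distToCube P C ≤ X.edgeDist P v :=
  Nat.sInf_le ⟨v, hv, rfl⟩

lemma exists_edgeDist_eq_distToCube (P : V) {C : Set V} (hC : C.Nonempty) :
    ∃ v ∈ C, X.edgeDist P v = X.distToCube P C :=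
  Nat.sInf_mem (hC.image (X.edgeDist P))

lemma IsCube.nonempty {q : ℕ} {C : Set V} (h : X.IsCube q C) : C.Nonempty := by
  obtain ⟨-, φ, hφ⟩ := h
  exact ⟨_, hφ.mem fun _ => false⟩

lemma Parallel.nonempty {C D : Set V} (h : X.Parallel C D) : D.Nonempty := by
  obtain ⟨⟨q, -, hD⟩, -⟩ := h
  exact hD.nonempty

end CubeComplex

/-! ### The nearest cube and the nearest vertex of a class -/

theorem mainTheorem4 {V : Type*} (X : CubeComplex V) (hX : X.IsCAT0) (P : V) (q : ℕ)
    (𝒞 : Set (Set V)) (h𝒞 : X.IsParallelismClass q 𝒞) :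
    (∃! C : Set V, C ∈ 𝒞 ∧ ∀ D ∈ 𝒞, X.distToCube P C ≤ X.distToCube P D) ∧
    (∃! R : V, X.IsNearestVertex P 𝒞 R) ∧
    (∀ R : V, X.IsNearestVertex P 𝒞 R →
      ∀ S ∈ ⋃₀ 𝒞, X.edgeDist P S = X.edgeDist P R + X.edgeDist R S) := by
  obtain ⟨C, hC, rfl⟩ := h𝒞
  have hCC : X.Parallel C C := ⟨⟨q, hC, hC⟩, fun _ _ h => h⟩
  obtain ⟨v, hv⟩ := hC.nonempty
  obtain ⟨R, hR, hgate⟩ := hX.exists_isGate_of_isConvex (hX.isConvex_sUnion_parallel hC)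
    ⟨v, C, hCC, hv⟩ P
  have huniq : ∀ S ∈ ⋃₀ {D | X.Parallel C D}, X.edgeDist P S ≤ X.edgeDist P R → S = R :=
    fun S hS hle => (hX.eq_of_edgeDist (by have := hgate S hS; omega)).symm
  have hmin : X.IsNearestVertex P {D | X.Parallel C D} R :=
    ⟨hR, fun S hS => by have := hgate S hS; omega⟩
  have heq : ∀ S, X.IsNearestVertex P {D | X.Parallel C D} S → S = R :=
    fun S hS => huniq S hS.1 (hS.2 R hR)
  refine ⟨?_, ⟨R, hmin, heq⟩, fun S hS => heq S hS ▸ hgate⟩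
  obtain ⟨D, hD, hRD⟩ := hR
  refine ⟨D, ⟨hD, fun E hE => ?_⟩, fun E ⟨hE, hEmin⟩ => ?_⟩
  · obtain ⟨w, hw, hwE⟩ := X.exists_edgeDist_eq_distToCube P (CubeComplex.Parallel.nonempty hE)
    exact (X.distToCube_le P hRD).trans ((hmin.2 w ⟨E, hE, hw⟩).trans_eq hwE)
  · obtain ⟨w, hw, hwE⟩ := X.exists_edgeDist_eq_distToCube P (CubeComplex.Parallel.nonempty hE)
    -- A vertex of `E` that realizes its distance is no farther from `P` than `R`, so it is `R`, and
    -- `E` meets `D`.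
    obtain rfl := huniq w ⟨E, hE, hw⟩
      (hwE.trans_le ((hEmin D hD).trans (X.distToCube_le P hRD)))
    exact hX.eq_of_parallel hC hE hD hw hRD
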